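/- Let $R$ be a rational map of degree at least $2$ (the quotient $P/Q$ of coprime complex polynomials with $\max(\deg P,\deg Q)\ge 2$), acting on the Riemann sphere $\widetilde{\mathbb C}=\mathbb C\cup\{\infty\}$. Its Fatou set $F(R)$ is the set of points that have an open neighbourhood on which every sequence of iterates $R^n$, $n\ge 1$, has a subsequence converging uniformly on compact subsets with respect to the spherical metric; its Julia set is $J(R)=\widetilde{\mathbb C}\setminus F(R)$. A point $w\in\widetilde{\mathbb C}$ is called exceptional if there are a point $z_0\in J(R)$ and a neighbourhood $U$ of $z_0$ such that $w\notin\bigcup_{n>0}R^n(U)$; let $E(R)$ be the set of exceptional points. A set $E\subset\widetilde{\mathbb C}$ is completely invariant if $R(E)=E=R^{-1}(E)$. Let $E\subset\widetilde{\mathbb C}$ be closed and completely invariant. Then either 1. $E$ has at most two elements and $E\subset E(R)\subset F(R)$; or 2. $E$ is infinite and $E\supset J(R)$. Moreover, $J(R)$ is the smallest closed completely invariant set with at least three points: $J(R)$ is itself closed, completely invariant and has at least three points, and it is contained in every closed completely invariant subset of $\widetilde{\mathbb C}$ with at least three points. -/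

import Mathlib

namespace RationalDynamics

noncomputable section

/-- The Riemann sphere `ℂ ∪ {∞}`, with the topology of the one-point compactification. -/
abbrev Sphere : Type := OnePoint ℂ

/-- The chordal metric on the Riemann sphere: the Euclidean length of the chord between the
stereographic projections of the two points. It is uniformly comparable with the
spherical (great circle) metric `σ₀`: `(2 / π) σ₀ ≤ σ ≤ σ₀`. -/
def chordalDist : Sphere → Sphere → ℝ
  | some z, some w => 2 * ‖z - w‖ / (Real.sqrt (1 + ‖z‖ ^ 2) * Real.sqrt (1 + ‖w‖ ^ 2))
  | some z, none => 2 / Real.sqrt (1 + ‖z‖ ^ 2)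
  | none, some w => 2 / Real.sqrt (1 + ‖w‖ ^ 2)
  | none, none => 0

/-- The degree of a rational function `P / Q` in lowest terms: the maximum of the degrees of
`P` and `Q`. -/
def ratDegree (R : RatFunc ℂ) : ℕ := max R.num.natDegree R.denom.natDegree

/-- The self-map of the Riemann sphere given by a rational function `P / Q` in lowest terms.
At `∞` the value is the limit of `P z / Q z` as `z → ∞`, which is the quotient of the
coefficients of index `max (deg P) (deg Q)`, and is `∞` if the coefficient of `Q` vanishes. -/
def ratMap (R : RatFunc ℂ) : Sphere → Sphere
  | some z =>
      if R.denom.eval z = 0 then OnePoint.infty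
      else ((R.num.eval z / R.denom.eval z : ℂ) : Sphere)
  | none =>
      if R.denom.coeff (ratDegree R) = 0 then OnePoint.infty
      else ((R.num.coeff (ratDegree R) / R.denom.coeff (ratDegree R) : ℂ) : Sphere)

/-- `f n → g` uniformly on every compact subset of `U`, in the metric of the sphere. -/
def ConvergesLocallyUniformlyOn (f : ℕ → Sphere → Sphere) (g : Sphere → Sphere)
    (U : Set Sphere) : Prop :=
  ∀ K : Set Sphere, IsCompact K → K ⊆ U →
    ∀ ε : ℝ, 0 < ε → ∃ N : ℕ, ∀ n : ℕ, N ≤ n → ∀ z ∈ K, chordalDist (f n z) (g z) < ε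

/-- A family of maps is normal on `U` if every sequence in the family has a subsequence that
converges locally uniformly on `U`. -/
def IsNormalFamilyOn (𝓕 : Set (Sphere → Sphere)) (U : Set Sphere) : Prop :=
  ∀ f : ℕ → Sphere → Sphere, (∀ n, f n ∈ 𝓕) →
    ∃ φ : ℕ → ℕ, StrictMono φ ∧
      ∃ g : Sphere → Sphere, ConvergesLocallyUniformlyOn (fun n => f (φ n)) g U

/-- The family of iterates `R, R², R³, …`. -/
def iterates (R : RatFunc ℂ) : Set (Sphere → Sphere) :=
  {f | ∃ n : ℕ, 0 < n ∧ f = (ratMap R)^[n]}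

/-- The Fatou set: the points having an open neighbourhood on which the iterates form a normal
family. -/
def fatouSet (R : RatFunc ℂ) : Set Sphere :=
  {z | ∃ U : Set Sphere, IsOpen U ∧ z ∈ U ∧ IsNormalFamilyOn (iterates R) U}

/-- The Julia set: the complement of the Fatou set. -/
def juliaSet (R : RatFunc ℂ) : Set Sphere := (fatouSet R)ᶜ

/-- The set `E_U` of points that are omitted by all the images `Rⁿ(U)`, `n > 0`. -/
def omittedSet (R : RatFunc ℂ) (U : Set Sphere) : Set Sphere :=
  (⋃ n : ℕ, ⋃ _ : 0 < n, (ratMap R)^[n] '' U)ᶜ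

/-- The set `E(R)` of exceptional points: the points that belong to `E_U` for some neighbourhood
`U` of some point of the Julia set. -/
def exceptionalSet (R : RatFunc ℂ) : Set Sphere :=
  {w | ∃ z₀ ∈ juliaSet R, ∃ U ∈ nhds z₀, w ∈ omittedSet R U}

/-- `E` is completely invariant under `g`: `g(E) = E = g⁻¹(E)`. -/
def CompletelyInvariant {X : Type*} (g : X → X) (E : Set X) : Prop :=
  g '' E = E ∧ g ⁻¹' E = E

end

end RationalDynamics

open Set Filter Topology Metric

namespace RationalDynamics

noncomputable section

/-! Two facts carry the theorem. The first is Montel's theorem for iterates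
(`subset_fatouSet_of_omits`): off a closed completely invariant set `E` the iterates omit `E`, so if
`E` has three points its complement lies in the Fatou set, that is, `J ⊆ E`. The second is
`subset_fatouSet_of_finite`: on a finite completely invariant set `R` is a permutation and every
point is alone in its fibre, so `R` contracts quadratically there and the set lies in the Fatou set.
As `J` is nonempty and completely invariant, it must be infinite; hence a closed completely
invariant set with three points is infinite. The set omitted by the images of a neighbourhood of a
Julia point has at most two points and is backward invariant, so the second fact also puts the
exceptional points in the Fatou set.

The local theory of `R` comes from a product formula in homogeneous coordinates (`exists_fibre`),
which yields surjectivity, continuity, openness and quadratic contraction without charts.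

Montel's theorem rests on a Landau bound (`exists_landau_bound`). If `f` omits `0` and `1`, sixth
roots of `f` and `1 - f` map the disc into the Fermat curve `x^6 + y^6 = 1`, where an explicit
metric of negative curvature is controlled by an Ahlfors–Schwarz argument. A Möbius map handles
three arbitrary omitted points, and Arzelà–Ascoli gives normality.

The Julia set is nonempty for a topological reason: otherwise the iterates would be normal on the
whole sphere, and two distinct iterates would be everywhere at distance less than `2`. Iterates of
different degrees are antipodal somewhere, by a winding number count
(`exists_dist_iterates_eq_two`). -/

/-! ### The chordal metric as a metric for the topology of the sphere. -/

lemma chordalDist_coe_coe (z w : ℂ) : chordalDist (z : Sphere) (w : Sphere) =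
    2 * ‖z - w‖ / (Real.sqrt (1 + ‖z‖ ^ 2) * Real.sqrt (1 + ‖w‖ ^ 2)) := rfl

lemma chordalDist_coe_infty (z : ℂ) : chordalDist (z : Sphere) OnePoint.infty =
    2 / Real.sqrt (1 + ‖z‖ ^ 2) := rfl

lemma chordalDist_infty_coe (z : ℂ) : chordalDist OnePoint.infty (z : Sphere) =
    2 / Real.sqrt (1 + ‖z‖ ^ 2) := rfl

lemma chordalDist_infty_infty : chordalDist OnePoint.infty OnePoint.infty = 0 := rfl

/-- The inverse stereographic projection of the Riemann sphere onto the unit sphere of `ℂ × ℝ`. -/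
def stereo : Sphere → WithLp 2 (ℂ × ℝ)
  | some z => WithLp.toLp 2 (((2 / (1 + ‖z‖ ^ 2) : ℝ) : ℂ) * z, 1 - 2 / (1 + ‖z‖ ^ 2))
  | none => WithLp.toLp 2 (0, 1)

lemma stereo_coe (z : ℂ) : stereo (z : Sphere) =
    WithLp.toLp 2 (((2 / (1 + ‖z‖ ^ 2) : ℝ) : ℂ) * z, 1 - 2 / (1 + ‖z‖ ^ 2)) := rfl

lemma stereo_infty : stereo OnePoint.infty = WithLp.toLp 2 (0, 1) := rfl

lemma dist_stereo_coe_infty (z : ℂ) :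
    dist (stereo (z : Sphere)) (stereo OnePoint.infty) = 2 / Real.sqrt (1 + ‖z‖ ^ 2) := by
  rw [WithLp.prod_dist_eq_of_L2, stereo_coe, stereo_infty]
  have h : (0 : ℝ) < 1 + ‖z‖ ^ 2 := by positivity
  rw [Real.sqrt_eq_iff_eq_sq (by positivity) (by positivity)]
  simp only [WithLp.toLp_fst, WithLp.toLp_snd, dist_eq_norm, sub_zero, norm_mul, Complex.norm_real, Real.norm_eq_abs,
    sq_abs, mul_pow, div_pow, Real.sq_sqrt h.le]
  field_simp
  ring

lemma dist_stereo_coe_coe (z w : ℂ) : dist (stereo (z : Sphere)) (stereo (w : Sphere)) =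
    2 * ‖z - w‖ / (Real.sqrt (1 + ‖z‖ ^ 2) * Real.sqrt (1 + ‖w‖ ^ 2)) := by
  rw [WithLp.prod_dist_eq_of_L2, stereo_coe, stereo_coe]
  have hz : (0 : ℝ) < 1 + ‖z‖ ^ 2 := by positivity
  have hw : (0 : ℝ) < 1 + ‖w‖ ^ 2 := by positivity
  rw [Real.sqrt_eq_iff_eq_sq (by positivity) (by positivity), div_pow, mul_pow _ (Real.sqrt _),
    Real.sq_sqrt hz.le, Real.sq_sqrt hw.le]
  simp only [WithLp.toLp_fst, WithLp.toLp_snd, dist_eq_norm, Real.norm_eq_abs, sq_abs]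
  rw [mul_pow]
  simp only [Complex.sq_norm, Complex.normSq_apply] at hz hw ⊢
  simp only [Complex.sub_re, Complex.sub_im, Complex.re_ofReal_mul, Complex.im_ofReal_mul]
  field_simp
  ring

lemma dist_stereo (p q : Sphere) : dist (stereo p) (stereo q) = chordalDist p q := by
  induction p using OnePoint.rec with
  | infty =>
    induction q using OnePoint.rec with
    | infty => simp [chordalDist_infty_infty]
    | coe w => rw [dist_comm, dist_stereo_coe_infty, chordalDist_infty_coe]
  | coe z =>
    induction q using OnePoint.rec with
    | infty => rw [dist_stereo_coe_infty, chordalDist_coe_infty]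
    | coe w => rw [dist_stereo_coe_coe, chordalDist_coe_coe]

lemma continuous_stereo : Continuous stereo := by
  rw [OnePoint.continuous_iff]
  constructor
  · rw [tendsto_iff_dist_tendsto_zero, Filter.coclosedCompact_eq_cocompact]
    simp only [dist_stereo_coe_infty]
    have h : Tendsto (fun z : ℂ => Real.sqrt (1 + ‖z‖ ^ 2)) (cocompact ℂ) atTop :=
      Real.tendsto_sqrt_atTop.comp (tendsto_atTop_add_const_left _ 1
        ((tendsto_pow_atTop two_ne_zero).comp (tendsto_norm_cocompact_atTop (E := ℂ))))
    simpa using h.const_div_atTop 2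
  · simp only [stereo_coe]
    refine (WithLp.prod_continuous_toLp 2 ℂ ℝ).comp ?_
    have h : ∀ z : ℂ, (1 + ‖z‖ ^ 2 : ℝ) ≠ 0 := fun z => by positivity
    refine Continuous.prodMk ?_ ?_
    · refine (Complex.continuous_ofReal.comp ?_).mul continuous_id
      exact continuous_const.div (by fun_prop) h
    · exact continuous_const.sub (continuous_const.div (by fun_prop) h)

lemma chordalDist_eq_zero {p q : Sphere} (h : chordalDist p q = 0) : p = q := by
  induction p using OnePoint.rec with
  | infty =>
    induction q using OnePoint.rec with
    | infty => rfl
    | coe w =>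
      rw [chordalDist_infty_coe] at h
      have : 0 < 2 / Real.sqrt (1 + ‖w‖ ^ 2) := by positivity
      exact absurd h this.ne'
  | coe z =>
    induction q using OnePoint.rec with
    | infty =>
      rw [chordalDist_coe_infty] at h
      have : 0 < 2 / Real.sqrt (1 + ‖z‖ ^ 2) := by positivity
      exact absurd h this.ne'
    | coe w =>
      rw [chordalDist_coe_coe] at h
      have hz : 0 < Real.sqrt (1 + ‖z‖ ^ 2) := by positivity
      have hw : 0 < Real.sqrt (1 + ‖w‖ ^ 2) := by positivity
      have := (div_eq_zero_iff.1 h).resolve_right (by positivity)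
      rw [show z = w by simpa [sub_eq_zero] using this]

/-- A continuous injection of a compact space into a Hausdorff one; the metric pulled back along it
therefore induces the topology of the one-point compactification. -/
lemma isEmbedding_stereo : IsEmbedding stereo :=
  (continuous_stereo.isClosedEmbedding fun p q h => chordalDist_eq_zero (by
    rw [← dist_stereo, h, dist_self])).isEmbedding

/-- The chordal metric on the Riemann sphere. -/
instance instMetricSpaceSphere : MetricSpace Sphere :=
  isEmbedding_stereo.comapMetricSpace stereo

lemma dist_eq_chordalDist (p q : Sphere) : dist p q = chordalDist p q := dist_stereo p q

/-! ### Homogeneous coordinates on the sphere. -/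

/-- The determinant of two vectors of `ℂ²`. -/
def wedge (v w : ℂ × ℂ) : ℂ := v.1 * w.2 - v.2 * w.1

/-- The Euclidean norm on `ℂ²`. -/
def hnorm (v : ℂ × ℂ) : ℝ := Real.sqrt (‖v.1‖ ^ 2 + ‖v.2‖ ^ 2)

/-- The point of the Riemann sphere with given homogeneous coordinates. -/
def toSphere (v : ℂ × ℂ) : Sphere :=
  if v.2 = 0 then OnePoint.infty else ((v.1 / v.2 : ℂ) : Sphere)

/-- Homogeneous coordinates for a point of the Riemann sphere. -/
def rep : Sphere → ℂ × ℂ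
  | some z => (z, 1)
  | none => (1, 0)

lemma rep_coe (z : ℂ) : rep (z : Sphere) = (z, 1) := rfl

lemma rep_infty : rep OnePoint.infty = (1, 0) := rfl

lemma rep_ne_zero (p : Sphere) : rep p ≠ 0 := by
  induction p using OnePoint.rec with
  | infty => simp [rep_infty]
  | coe z => simp [rep_coe]

@[simp] lemma toSphere_rep (p : Sphere) : toSphere (rep p) = p := by
  induction p using OnePoint.rec with
  | infty => simp [rep_infty, toSphere]
  | coe z => simp [rep_coe, toSphere]

lemma hnorm_sq (v : ℂ × ℂ) : hnorm v ^ 2 = ‖v.1‖ ^ 2 + ‖v.2‖ ^ 2 := Real.sq_sqrt (by positivity)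

lemma hnorm_nonneg (v : ℂ × ℂ) : 0 ≤ hnorm v := Real.sqrt_nonneg _

lemma hnorm_pos {v : ℂ × ℂ} (hv : v ≠ 0) : 0 < hnorm v := by
  apply Real.sqrt_pos.2
  by_cases h : v.1 = 0
  · have : v.2 ≠ 0 := fun h2 => hv (Prod.ext h h2)
    positivity
  · positivity

lemma hnorm_smul (c : ℂ) (v : ℂ × ℂ) : hnorm (c • v) = ‖c‖ * hnorm v := by
  unfold hnorm
  rw [← Real.sqrt_sq (norm_nonneg c), ← Real.sqrt_mul (by positivity)]
  simp only [Prod.smul_fst, Prod.smul_snd, smul_eq_mul, norm_mul]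
  ring_nf

@[fun_prop] lemma continuous_hnorm : Continuous hnorm := by unfold hnorm; fun_prop

lemma toSphere_smul {c : ℂ} (hc : c ≠ 0) (v : ℂ × ℂ) : toSphere (c • v) = toSphere v := by
  simp only [toSphere, Prod.smul_fst, Prod.smul_snd, smul_eq_mul, mul_eq_zero, hc, false_or,
    mul_div_mul_left _ _ hc]

lemma exists_smul_rep {v : ℂ × ℂ} (hv : v ≠ 0) :
    ∃ c : ℂ, c ≠ 0 ∧ v = c • rep (toSphere v) := by
  by_cases h : v.2 = 0
  · refine ⟨v.1, fun h1 => hv (Prod.ext h1 h), ?_⟩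
    simp [toSphere, h, rep_infty, Prod.ext_iff]
  · refine ⟨v.2, h, ?_⟩
    simp [toSphere, h, rep_coe, mul_div_cancel₀]

lemma dist_eq_wedge_rep (p q : Sphere) :
    dist p q = 2 * ‖wedge (rep p) (rep q)‖ / (hnorm (rep p) * hnorm (rep q)) := by
  rw [dist_eq_chordalDist]
  induction p using OnePoint.rec with
  | infty =>
    induction q using OnePoint.rec with
    | infty => simp [chordalDist_infty_infty, rep_infty, wedge]
    | coe w =>
      simp [chordalDist_infty_coe, rep_infty, rep_coe, wedge, hnorm, add_comm]
  | coe z =>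
    induction q using OnePoint.rec with
    | infty => simp [chordalDist_coe_infty, rep_infty, rep_coe, wedge, hnorm, add_comm]
    | coe w => simp [chordalDist_coe_coe, rep_coe, wedge, hnorm, add_comm]

lemma wedge_smul_smul (a b : ℂ) (v w : ℂ × ℂ) : wedge (a • v) (b • w) = a * b * wedge v w := by
  simp [wedge]; ring

lemma dist_toSphere {v w : ℂ × ℂ} (hv : v ≠ 0) (hw : w ≠ 0) :
    dist (toSphere v) (toSphere w) = 2 * ‖wedge v w‖ / (hnorm v * hnorm w) := by
  obtain ⟨a, ha, hva⟩ := exists_smul_rep hv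
  obtain ⟨b, hb, hwb⟩ := exists_smul_rep hw
  have h1 := norm_pos_iff.2 ha
  have h2 := norm_pos_iff.2 hb
  have h3 := hnorm_pos (rep_ne_zero (toSphere v))
  have h4 := hnorm_pos (rep_ne_zero (toSphere w))
  conv_rhs => rw [hva, hwb, wedge_smul_smul, hnorm_smul, hnorm_smul]
  rw [dist_eq_wedge_rep, norm_mul, norm_mul]
  field_simp

lemma toSphere_eq_iff {v w : ℂ × ℂ} (hv : v ≠ 0) (hw : w ≠ 0) :
    toSphere v = toSphere w ↔ wedge v w = 0 := by
  have h1 := hnorm_pos hv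
  have h2 := hnorm_pos hw
  rw [← dist_eq_zero, dist_toSphere hv hw, div_eq_zero_iff]
  simp [h1.ne', h2.ne']

lemma exists_dist_eq_two (p : Sphere) : ∃ q, dist q p = 2 := by
  have hr := rep_ne_zero p
  set v := rep p with hv
  -- The Hermitian orthogonal of `v`, which represents the antipode.
  set u : ℂ × ℂ := (-(starRingEnd ℂ) v.2, (starRingEnd ℂ) v.1) with hu
  have hun : hnorm u = hnorm v := by simp [hnorm, hu, add_comm]
  have hu0 : u ≠ 0 := fun h => hr (by
    simp only [hu, Prod.ext_iff, Prod.fst_zero, Prod.snd_zero, neg_eq_zero, map_eq_zero] at h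
    exact Prod.ext h.2 h.1)
  refine ⟨toSphere u, ?_⟩
  rw [← toSphere_rep p, dist_toSphere hu0 hr, hun]
  have h1 := hnorm_pos hr
  have : wedge u v = -((hnorm v ^ 2 : ℝ) : ℂ) := by
    rw [hnorm_sq]
    simp only [wedge, hu, Complex.ofReal_add, Complex.ofReal_pow, ← Complex.conj_mul']
    ring
  rw [this, norm_neg, Complex.norm_real, Real.norm_of_nonneg (by positivity)]
  field_simp

lemma dist_le_two (p q : Sphere) : dist p q ≤ 2 := by
  rw [dist_eq_wedge_rep]
  have h1 := hnorm_pos (rep_ne_zero p)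
  have h2 := hnorm_pos (rep_ne_zero q)
  rw [div_le_iff₀ (by positivity)]
  gcongr
  set v := rep p
  set w := rep q
  have h3 : ‖wedge v w‖ ≤ ‖v.1‖ * ‖w.2‖ + ‖v.2‖ * ‖w.1‖ := by
    refine (norm_sub_le _ _).trans ?_
    rw [norm_mul, norm_mul]
  refine h3.trans ?_
  rw [← Real.sqrt_sq h1.le, ← Real.sqrt_sq h2.le, ← Real.sqrt_mul (by positivity)]
  apply Real.le_sqrt_of_sq_le
  rw [hnorm_sq, hnorm_sq]
  nlinarith [sq_nonneg (‖v.1‖ * ‖w.1‖ - ‖v.2‖ * ‖w.2‖)]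

lemma continuousOn_toSphere : ContinuousOn toSphere {v | v ≠ 0} := by
  intro v hv
  have hv : v ≠ 0 := hv
  rw [ContinuousWithinAt, tendsto_iff_dist_tendsto_zero]
  have h1 := hnorm_pos hv
  have h : ContinuousAt (fun w => 2 * ‖wedge w v‖ / (hnorm w * hnorm v)) v := by
    refine ContinuousAt.div (by unfold wedge; fun_prop) (by fun_prop) (by positivity)
  have h0 : 2 * ‖wedge v v‖ / (hnorm v * hnorm v) = 0 := by
    simp [wedge, mul_comm]
  have := h.tendsto
  rw [h0] at this
  refine (this.mono_left nhdsWithin_le_nhds).congr' ?_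
  filter_upwards [self_mem_nhdsWithin] with w hw
  exact (dist_toSphere hw hv).symm

/-! ### The homogeneous lift of a rational map. -/

/-- The value at a vector of `ℂ²` of the binary form of degree `d` obtained by homogenizing `p`. -/
def homEval (p : Polynomial ℂ) (d : ℕ) (v : ℂ × ℂ) : ℂ :=
  ∑ i ∈ Finset.range (d + 1), p.coeff i * v.1 ^ i * v.2 ^ (d - i)

@[fun_prop] lemma continuous_homEval (p : Polynomial ℂ) (d : ℕ) : Continuous (homEval p d) := by
  unfold homEval; fun_prop

lemma homEval_of_ne {p : Polynomial ℂ} {d : ℕ} (hd : p.natDegree ≤ d) {v : ℂ × ℂ}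
    (hv : v.2 ≠ 0) : homEval p d v = v.2 ^ d * p.eval (v.1 / v.2) := by
  rw [Polynomial.eval_eq_sum_range' (Nat.lt_succ_of_le hd), homEval, Finset.mul_sum]
  refine Finset.sum_congr rfl fun i hi => ?_
  have hi : i ≤ d := Nat.lt_succ_iff.1 (Finset.mem_range.1 hi)
  rw [div_pow, ← Nat.sub_add_cancel hi, pow_add, Nat.add_sub_cancel]
  field_simp

lemma homEval_of_eq (p : Polynomial ℂ) (d : ℕ) {v : ℂ × ℂ} (hv : v.2 = 0) :
    homEval p d v = p.coeff d * v.1 ^ d := by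
  rw [homEval, Finset.sum_eq_single d]
  · simp
  · intro i hi hid
    have : d - i ≠ 0 := by
      have := Finset.mem_range.1 hi
      omega
    simp [hv, this]
  · simp

lemma homEval_smul (p : Polynomial ℂ) (d : ℕ) (c : ℂ) (v : ℂ × ℂ) :
    homEval p d (c • v) = c ^ d * homEval p d v := by
  rw [homEval, homEval, Finset.mul_sum]
  refine Finset.sum_congr rfl fun i hi => ?_
  have hi : i ≤ d := Nat.lt_succ_iff.1 (Finset.mem_range.1 hi)
  conv_rhs => rw [← Nat.sub_add_cancel hi, pow_add, Nat.add_sub_cancel]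
  simp only [Prod.smul_fst, Prod.smul_snd, smul_eq_mul, mul_pow]
  ring

/-- A binary form over `ℂ` splits into linear factors: the roots of `p`, and `∞` with multiplicity
equal to the deficit `d - p.natDegree`. -/
lemma norm_homEval_eq_prod (p : Polynomial ℂ) {d : ℕ} (hd : p.natDegree ≤ d) :
    ∃ s : Multiset Sphere, Multiset.card s = d ∧ ∀ v : ℂ × ℂ,
      ‖homEval p d v‖ = ‖p.leadingCoeff‖ * (s.map fun a => ‖wedge v (rep a)‖).prod := by
  have hsp := IsAlgClosed.splits p
  have hcard : Multiset.card p.roots = p.natDegree := hsp.natDegree_eq_card_roots.symm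
  refine ⟨Multiset.map (fun a : ℂ => (OnePoint.some a : Sphere)) p.roots +
    Multiset.replicate (d - p.natDegree) OnePoint.infty, ?_, fun v => ?_⟩
  · simp [hcard, hd]
  simp only [Multiset.map_add, Multiset.map_map, Multiset.map_replicate, Multiset.prod_add,
    Multiset.prod_replicate, Function.comp_def, rep_coe, rep_infty, wedge, mul_one, mul_zero,
    zero_sub, norm_neg]
  by_cases hv : v.2 = 0
  · rw [homEval_of_eq p d hv]
    simp only [hv, zero_mul, sub_zero, Multiset.map_const', Multiset.prod_replicate, hcard,
      norm_mul, norm_pow, norm_zero]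
    rcases hd.eq_or_lt with h | h
    · simp [← h]
    · rw [Polynomial.coeff_eq_zero_of_natDegree_lt h, zero_pow (by omega)]
      simp
  · rw [homEval_of_ne hd hv, hsp.eval_eq_prod_roots]
    have h1 : (p.roots.map fun a => ‖v.1 - v.2 * a‖).prod =
        ‖v.2‖ ^ p.natDegree * ‖(p.roots.map fun a => v.1 / v.2 - a).prod‖ := by
      rw [← hcard, ← Multiset.prod_replicate, ← Multiset.map_const',
        show ‖(p.roots.map fun a => v.1 / v.2 - a).prod‖ = _ from
          map_multiset_prod (normHom : ℂ →*₀ ℝ) _, Multiset.map_map, ← Multiset.prod_map_mul]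
      congr 1
      refine Multiset.map_congr rfl fun a _ => ?_
      change _ = ‖v.2‖ * ‖v.1 / v.2 - a‖
      rw [← norm_mul, mul_sub, mul_div_cancel₀ _ hv]
    rw [h1, norm_mul, norm_mul, norm_pow]
    conv_lhs => rw [← Nat.sub_add_cancel hd, pow_add]
    ring

lemma natDegree_num_le (R : RatFunc ℂ) : R.num.natDegree ≤ ratDegree R := le_max_left _ _

lemma natDegree_denom_le (R : RatFunc ℂ) : R.denom.natDegree ≤ ratDegree R := le_max_right _ _

/-- The lift of a rational map to a homogeneous polynomial map of `ℂ²`. -/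
def homLift (R : RatFunc ℂ) (v : ℂ × ℂ) : ℂ × ℂ :=
  (homEval R.num (ratDegree R) v, homEval R.denom (ratDegree R) v)

@[fun_prop] lemma continuous_homLift (R : RatFunc ℂ) : Continuous (homLift R) := by
  unfold homLift; fun_prop

lemma homLift_smul (R : RatFunc ℂ) (c : ℂ) (v : ℂ × ℂ) :
    homLift R (c • v) = c ^ ratDegree R • homLift R v := by
  simp [homLift, homEval_smul]

/-- At finite points this is coprimality of numerator and denominator; at `∞` one of the two
coefficients of index `ratDegree R` is a leading coefficient. -/
lemma homLift_ne_zero (R : RatFunc ℂ) {v : ℂ × ℂ} (hv : v ≠ 0) : homLift R v ≠ 0 := by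
  intro h
  simp only [homLift, Prod.mk_eq_zero] at h
  obtain ⟨h1, h2⟩ := h
  by_cases hy : v.2 = 0
  · have hx : v.1 ≠ 0 := fun hx => hv (Prod.ext hx hy)
    rw [homEval_of_eq _ _ hy] at h1 h2
    have h1 := (mul_eq_zero.1 h1).resolve_right (pow_ne_zero _ hx)
    have h2 := (mul_eq_zero.1 h2).resolve_right (pow_ne_zero _ hx)
    have hden := R.denom_ne_zero
    rcases le_total R.num.natDegree R.denom.natDegree with hle | hle
    · rw [ratDegree, max_eq_right hle] at h2
      exact hden (Polynomial.leadingCoeff_eq_zero.1 h2)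
    · rw [ratDegree, max_eq_left hle] at h1 h2
      have hn := Polynomial.leadingCoeff_eq_zero.1 h1
      rw [hn, Polynomial.natDegree_zero] at hle h2
      rw [← Nat.le_zero.1 hle] at h2
      exact hden (Polynomial.leadingCoeff_eq_zero.1 h2)
  · rw [homEval_of_ne (natDegree_num_le R) hy] at h1
    rw [homEval_of_ne (natDegree_denom_le R) hy] at h2
    have h1 := (mul_eq_zero.1 h1).resolve_left (pow_ne_zero _ hy)
    have h2 := (mul_eq_zero.1 h2).resolve_left (pow_ne_zero _ hy)
    obtain ⟨a, b, hab⟩ := R.isCoprime_num_denom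
    have := congrArg (Polynomial.eval (v.1 / v.2)) hab
    simp [h1, h2] at this

lemma toSphere_homLift_rep (R : RatFunc ℂ) (p : Sphere) :
    toSphere (homLift R (rep p)) = ratMap R p := by
  induction p using OnePoint.rec with
  | infty =>
    rw [rep_infty, homLift, homEval_of_eq _ _ rfl, homEval_of_eq _ _ rfl]
    simp only [one_pow, mul_one, toSphere]
    rfl
  | coe z =>
    rw [rep_coe, homLift, homEval_of_ne (natDegree_num_le R) (by simp),
      homEval_of_ne (natDegree_denom_le R) (by simp)]
    simp only [one_pow, one_mul, div_one, toSphere]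
    rfl

lemma toSphere_homLift (R : RatFunc ℂ) {v : ℂ × ℂ} (hv : v ≠ 0) :
    toSphere (homLift R v) = ratMap R (toSphere v) := by
  obtain ⟨c, hc, h⟩ := exists_smul_rep hv
  rw [← toSphere_homLift_rep]
  conv_lhs => rw [h, homLift_smul, toSphere_smul (pow_ne_zero _ hc)]

lemma homLift_iterate_ne_zero (R : RatFunc ℂ) (n : ℕ) {v : ℂ × ℂ} (hv : v ≠ 0) :
    (homLift R)^[n] v ≠ 0 := by
  induction n with
  | zero => exact hv
  | succ n ih => rw [Function.iterate_succ_apply']; exact homLift_ne_zero R ih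

lemma toSphere_homLift_iterate (R : RatFunc ℂ) (n : ℕ) {v : ℂ × ℂ} (hv : v ≠ 0) :
    toSphere ((homLift R)^[n] v) = (ratMap R)^[n] (toSphere v) := by
  induction n with
  | zero => rfl
  | succ n ih =>
    rw [Function.iterate_succ_apply', Function.iterate_succ_apply', ← ih,
      toSphere_homLift R (homLift_iterate_ne_zero R n hv)]

lemma homLift_iterate_smul (R : RatFunc ℂ) (n : ℕ) (c : ℂ) (v : ℂ × ℂ) :
    (homLift R)^[n] (c • v) = c ^ (ratDegree R ^ n) • (homLift R)^[n] v := by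
  induction n with
  | zero => simp
  | succ n ih =>
    rw [Function.iterate_succ_apply', Function.iterate_succ_apply', ih, homLift_smul, ← pow_mul,
      ← pow_succ]

/-- The factor by which the homogeneous lift changes the norm on the line of a point. -/
def stretch (R : RatFunc ℂ) (p : Sphere) : ℝ :=
  hnorm (homLift R (rep p)) / hnorm (rep p) ^ ratDegree R

lemma stretch_toSphere (R : RatFunc ℂ) {v : ℂ × ℂ} (hv : v ≠ 0) :
    stretch R (toSphere v) = hnorm (homLift R v) / hnorm v ^ ratDegree R := by
  obtain ⟨c, hc, h⟩ := exists_smul_rep hv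
  have hc' := norm_pos_iff.2 hc
  conv_rhs => rw [h, homLift_smul, hnorm_smul, hnorm_smul, norm_pow, mul_pow]
  rw [stretch, mul_div_mul_left _ _ (by positivity)]

/-- By homogeneity it suffices to look at the unit sphere of `ℂ²`, where compactness applies. -/
lemma exists_stretch_bounds (R : RatFunc ℂ) :
    ∃ m > 0, ∃ M > 0, ∀ p, m ≤ stretch R p ∧ stretch R p ≤ M := by
  have hK : IsCompact (sphere (0 : ℂ × ℂ) 1) := isCompact_sphere 0 1
  have hne : ∀ v ∈ sphere (0 : ℂ × ℂ) 1, v ≠ 0 := fun v hv => ne_zero_of_mem_unit_sphere ⟨v, hv⟩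
  have hcont : ContinuousOn (fun v => hnorm (homLift R v) / hnorm v ^ ratDegree R)
      (sphere (0 : ℂ × ℂ) 1) := by
    refine ContinuousOn.div (by fun_prop) (by fun_prop) fun v hv => ?_
    exact pow_ne_zero _ (hnorm_pos (hne v hv)).ne'
  have hpos : ∀ v ∈ sphere (0 : ℂ × ℂ) 1, 0 < hnorm (homLift R v) / hnorm v ^ ratDegree R :=
    fun v hv => div_pos (hnorm_pos (homLift_ne_zero R (hne v hv)))
      (pow_pos (hnorm_pos (hne v hv)) _)
  have hS : (sphere (0 : ℂ × ℂ) 1).Nonempty := ⟨(1, 0), by simp⟩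
  obtain ⟨v₀, hv₀, hmin⟩ := hK.exists_isMinOn hS hcont
  obtain ⟨v₁, hv₁, hmax⟩ := hK.exists_isMaxOn hS hcont
  refine ⟨_, hpos v₀ hv₀, _, hpos v₁ hv₁, fun p => ?_⟩
  have hp := norm_pos_iff.2 (rep_ne_zero p)
  set v := ((‖rep p‖⁻¹ : ℝ) : ℂ) • rep p with hv
  have hvS : v ∈ sphere (0 : ℂ × ℂ) 1 := by
    rw [mem_sphere_zero_iff_norm, hv, norm_smul, Complex.norm_real, norm_inv, norm_norm,
      inv_mul_cancel₀ hp.ne']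
  have hvp : toSphere v = p := by
    rw [hv, toSphere_smul (by simpa using rep_ne_zero p), toSphere_rep]
  rw [← hvp, stretch_toSphere R (hne v hvS)]
  exact ⟨hmin hvS, hmax hvS⟩

/-! ### Fibres of a rational map, and the local behaviour they determine. -/

lemma pencil_ne_zero {R : RatFunc ℂ} (hR : 1 ≤ ratDegree R) (w : Sphere) :
    Polynomial.C (rep w).2 * R.num - Polynomial.C (rep w).1 * R.denom ≠ 0 := by
  induction w using OnePoint.rec with
  | infty => simpa [rep_infty] using R.denom_ne_zero
  | coe w =>
    simp only [rep_coe, Polynomial.C_1, one_mul]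
    intro h
    rw [sub_eq_zero] at h
    have hu : IsUnit R.denom := by
      have := R.isCoprime_num_denom
      rw [h] at this
      exact (isCoprime_self.1 this.of_mul_left_right)
    have hd := Polynomial.natDegree_eq_zero_of_isUnit hu
    have hn : R.num.natDegree = 0 := by
      rw [h]
      exact Nat.le_zero.1 ((Polynomial.natDegree_C_mul_le _ _).trans hd.le)
    rw [ratDegree, hd, hn] at hR
    simp at hR

/-- The chordal distance of `R z` to a point `w` is, up to bounded factors, the product of the
chordal distances of `z` to the preimages of `w`. -/
theorem exists_fibre {R : RatFunc ℂ} (hR : 1 ≤ ratDegree R) (w : Sphere) :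
    ∃ s : Multiset Sphere, Multiset.card s = ratDegree R ∧ ∃ c > 0, ∀ z,
      dist (ratMap R z) w * stretch R z = c * (s.map fun a => dist z a).prod := by
  set q := Polynomial.C (rep w).2 * R.num - Polynomial.C (rep w).1 * R.denom with hq
  have hq0 : q ≠ 0 := pencil_ne_zero hR w
  have hqd : q.natDegree ≤ ratDegree R := by
    refine (Polynomial.natDegree_sub_le _ _).trans (max_le_max ?_ ?_) <;>
      exact Polynomial.natDegree_C_mul_le _ _
  obtain ⟨s, hs, hprod⟩ := norm_homEval_eq_prod q hqd
  have hw := hnorm_pos (rep_ne_zero w)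
  have hsp : 0 < (s.map fun a => hnorm (rep a) / 2).prod :=
    Multiset.prod_pos (by
      intro x hx
      obtain ⟨a, -, rfl⟩ := Multiset.mem_map.1 hx
      exact half_pos (hnorm_pos (rep_ne_zero a)))
  have hl : 0 < ‖q.leadingCoeff‖ := norm_pos_iff.2 (Polynomial.leadingCoeff_ne_zero.2 hq0)
  refine ⟨s, hs, 2 * ‖q.leadingCoeff‖ * (s.map fun a => hnorm (rep a) / 2).prod / hnorm (rep w),
    by positivity, fun z => ?_⟩
  have hz := hnorm_pos (rep_ne_zero z)
  have hFz := homLift_ne_zero R (rep_ne_zero z)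
  have hFz' := hnorm_pos hFz
  have hwedge : wedge (homLift R (rep z)) (rep w) = homEval q (ratDegree R) (rep z) := by
    simp only [wedge, homLift, homEval, hq, Finset.sum_mul, ← Finset.sum_sub_distrib]
    refine Finset.sum_congr rfl fun i _ => ?_
    simp only [Polynomial.coeff_sub, Polynomial.coeff_C_mul]
    ring
  have hfac : (s.map fun a => ‖wedge (rep z) (rep a)‖).prod =
      hnorm (rep z) ^ ratDegree R * ((s.map fun a => hnorm (rep a) / 2).prod *
        (s.map fun a => dist z a).prod) := by
    rw [← hs, ← Multiset.prod_replicate, ← Multiset.map_const', ← Multiset.prod_map_mul,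
      ← Multiset.prod_map_mul]
    congr 1
    refine Multiset.map_congr rfl fun a _ => ?_
    have ha := hnorm_pos (rep_ne_zero a)
    rw [dist_eq_wedge_rep]
    field_simp
  rw [← toSphere_homLift_rep, ← toSphere_rep w, dist_toSphere hFz (rep_ne_zero w), toSphere_rep,
    stretch, hwedge, hprod, hfac]
  field_simp

/-- Since `stretch` never vanishes, the two sides of the product formula vanish together, so the
factors are exactly the points of the fibre. -/
theorem exists_fibre_mem {R : RatFunc ℂ} (hR : 1 ≤ ratDegree R) (w : Sphere) :
    ∃ s : Multiset Sphere, Multiset.card s = ratDegree R ∧ (∀ a, a ∈ s ↔ ratMap R a = w) ∧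
      ∃ c > 0, ∀ z, dist (ratMap R z) w * stretch R z = c * (s.map fun a => dist z a).prod := by
  obtain ⟨s, hs, c, hc, h⟩ := exists_fibre hR w
  refine ⟨s, hs, fun a => ?_, c, hc, h⟩
  obtain ⟨m, hm, M, -, hb⟩ := exists_stretch_bounds R
  have ha := h a
  have hpos := hm.trans_le (hb a).1
  rw [← dist_eq_zero (x := ratMap R a)]
  constructor
  · intro has
    have : (s.map fun b => dist a b).prod = 0 :=
      Multiset.prod_eq_zero (Multiset.mem_map.2 ⟨a, has, dist_self a⟩)
    rw [this, mul_zero] at ha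
    exact (mul_eq_zero.1 ha).resolve_right hpos.ne'
  · intro h0
    rw [h0, zero_mul] at ha
    have := (mul_eq_zero.1 ha.symm).resolve_left hc.ne'
    obtain ⟨b, hb, hab⟩ := Multiset.mem_map.1 (Multiset.prod_eq_zero_iff.1 this)
    rwa [dist_eq_zero.1 hab]

theorem surjective_ratMap {R : RatFunc ℂ} (hR : 1 ≤ ratDegree R) :
    Function.Surjective (ratMap R) := by
  intro w
  obtain ⟨s, hs, hmem, -⟩ := exists_fibre_mem hR w
  obtain ⟨a, ha⟩ := Multiset.card_pos_iff_exists_mem.1 (by omega : 0 < Multiset.card s)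
  exact ⟨a, (hmem a).1 ha⟩

theorem continuous_ratMap {R : RatFunc ℂ} (hR : 1 ≤ ratDegree R) : Continuous (ratMap R) := by
  rw [continuous_iff_continuousAt]
  intro z₀
  obtain ⟨s, hs, hmem, c, hc, h⟩ := exists_fibre_mem hR (ratMap R z₀)
  obtain ⟨m, hm, M, -, hb⟩ := exists_stretch_bounds R
  rw [ContinuousAt, tendsto_iff_dist_tendsto_zero]
  have hlim : Tendsto (fun z => c * (s.map fun a => dist z a).prod / m) (𝓝 z₀) (𝓝 0) := by
    have h1 : Continuous fun z => c * (s.map fun a => dist z a).prod / m := by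
      have : Continuous fun z => (s.map fun a => dist z a).prod :=
        continuous_multiset_prod s fun a _ => by fun_prop
      fun_prop
    have h2 := h1.tendsto z₀
    have h3 : (s.map fun b => dist z₀ b).prod = 0 :=
      Multiset.prod_eq_zero (Multiset.mem_map.2 ⟨z₀, (hmem z₀).2 rfl, dist_self z₀⟩)
    simpa [h3] using h2
  refine squeeze_zero (fun _ => dist_nonneg) (fun z => ?_) hlim
  rw [le_div_iff₀ hm, ← h z]
  exact mul_le_mul_of_nonneg_left (hb z).1 dist_nonneg

-- The preimage nearest to `z` contributes the smallest of the `ratDegree R` factors in the product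
-- formula. The constant must not depend on `w`; this quantitative form gives openness.
open scoped Classical in
theorem exists_preimage_dist_le {R : RatFunc ℂ} (hR : 1 ≤ ratDegree R) :
    ∃ K > 0, ∀ z w, ∃ a, ratMap R a = w ∧ dist z a ^ ratDegree R ≤ K * dist (ratMap R z) w := by
  obtain ⟨m, hm, M, hM, hb⟩ := exists_stretch_bounds R
  set d := ratDegree R with hd
  refine ⟨2 ^ d * M / (2 * m), by positivity, fun z w => ?_⟩
  obtain ⟨s, hs, hmem, c, hc, h⟩ := exists_fibre_mem hR w
  -- A lower bound for `c` uniform in `w`: evaluate the formula at a preimage of the antipode of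
  -- `w`, where every factor is at most `2`.
  have hc' : 2 * m ≤ c * 2 ^ d := by
    obtain ⟨w', hw'⟩ := exists_dist_eq_two w
    obtain ⟨z', rfl⟩ := surjective_ratMap hR w'
    have h1 := h z'
    rw [hw'] at h1
    have h2 : (s.map fun a => dist z' a).prod ≤ 2 ^ d := by
      rw [hd, ← hs, ← Multiset.prod_replicate, ← Multiset.map_const']
      exact Multiset.prod_map_le_prod_map₀ _ _ (fun _ _ => dist_nonneg) fun a _ => dist_le_two z' a
    calc 2 * m ≤ 2 * stretch R z' := by linarith [(hb z').1]
      _ ≤ c * 2 ^ d := by rw [h1]; gcongr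
  have hne : s.toFinset.Nonempty := by
    obtain ⟨a, ha⟩ := Multiset.card_pos_iff_exists_mem.1 (by omega : 0 < Multiset.card s)
    exact ⟨a, Multiset.mem_toFinset.2 ha⟩
  obtain ⟨a, ha, hmin⟩ := s.toFinset.exists_min_image (fun a => dist z a) hne
  rw [Multiset.mem_toFinset] at ha
  refine ⟨a, (hmem a).1 ha, ?_⟩
  have h2 : dist z a ^ d ≤ (s.map fun a => dist z a).prod := by
    rw [hd, ← hs, ← Multiset.prod_replicate, ← Multiset.map_const']
    exact Multiset.prod_map_le_prod_map₀ _ _ (fun _ _ => dist_nonneg)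
      fun b hb => hmin b (Multiset.mem_toFinset.2 hb)
  rw [div_mul_eq_mul_div, le_div_iff₀ (by positivity)]
  have hnn : 0 ≤ dist z a ^ d := by positivity
  calc dist z a ^ d * (2 * m) ≤ dist z a ^ d * (c * 2 ^ d) := by gcongr
    _ ≤ (c * (s.map fun a => dist z a).prod) * 2 ^ d := by
        rw [mul_left_comm, ← mul_assoc]; gcongr
    _ = dist (ratMap R z) w * stretch R z * 2 ^ d := by rw [h]
    _ ≤ dist (ratMap R z) w * M * 2 ^ d := by gcongr; exact (hb z).2
    _ = 2 ^ d * M * dist (ratMap R z) w := by ring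

theorem isOpenMap_ratMap {R : RatFunc ℂ} (hR : 1 ≤ ratDegree R) : IsOpenMap (ratMap R) := by
  obtain ⟨K, hK, h⟩ := exists_preimage_dist_le hR
  intro U hU
  rw [Metric.isOpen_iff]
  rintro _ ⟨z, hz, rfl⟩
  obtain ⟨ε, hε, hball⟩ := Metric.isOpen_iff.1 hU z hz
  refine ⟨ε ^ ratDegree R / K, by positivity, fun w hw => ?_⟩
  obtain ⟨a, rfl, ha⟩ := h z w
  refine ⟨a, hball ?_, rfl⟩
  rw [mem_ball, dist_comm, lt_div_iff₀ hK, mul_comm] at hw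
  rw [mem_ball, dist_comm]
  exact lt_of_pow_lt_pow_left₀ _ hε.le (ha.trans_lt hw)

/-- Near a point that is alone in its fibre, a rational map contracts quadratically. -/
theorem exists_dist_le_sq {R : RatFunc ℂ} (hR : 2 ≤ ratDegree R) {a : Sphere}
    (ha : ∀ b, ratMap R b = ratMap R a → b = a) :
    ∃ C > 0, ∀ z, dist (ratMap R z) (ratMap R a) ≤ C * dist z a ^ 2 := by
  obtain ⟨s, hs, hmem, c, hc, h⟩ := exists_fibre_mem (one_le_two.trans hR) (ratMap R a)
  obtain ⟨m, hm, M, -, hb⟩ := exists_stretch_bounds R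
  have hsa : s = Multiset.replicate (ratDegree R) a :=
    Multiset.eq_replicate.2 ⟨hs, fun b hb => ha b ((hmem b).1 hb)⟩
  refine ⟨c * 2 ^ (ratDegree R - 2) / m, by positivity, fun z => ?_⟩
  rw [div_mul_eq_mul_div, le_div_iff₀ hm]
  calc dist (ratMap R z) (ratMap R a) * m ≤ dist (ratMap R z) (ratMap R a) * stretch R z := by
        gcongr; exact (hb z).1
    _ = c * (dist z a ^ (ratDegree R - 2) * dist z a ^ 2) := by
        rw [h, hsa, Multiset.map_replicate, Multiset.prod_replicate, ← pow_add,
          Nat.sub_add_cancel hR]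
    _ ≤ c * (2 ^ (ratDegree R - 2) * dist z a ^ 2) := by
        gcongr; exact dist_le_two z a
    _ = _ := by ring

/-! ### The Landau bound by the Ahlfors–Schwarz method. -/

/-- Polarization: for fixed `a` the first term on the right is the squared modulus of a holomorphic
function of `b`, and the second-order error `‖b - a‖ ^ 2` carries the curvature. This and the next
identity replace the computation of a Laplacian. -/
lemma one_add_sq_mul_one_add_sq (a b : ℂ) : (1 + ‖a‖ ^ 2) * (1 + ‖b‖ ^ 2) =
    ‖1 + (starRingEnd ℂ) a * b‖ ^ 2 + ‖b - a‖ ^ 2 := by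
  simp only [Complex.sq_norm, Complex.normSq_apply, Complex.add_re, Complex.add_im, Complex.mul_re,
    Complex.mul_im, Complex.conj_re, Complex.conj_im, Complex.one_re, Complex.one_im,
    Complex.sub_re, Complex.sub_im]
  ring

lemma sq_sub_sq_mul_sq_sub_sq (r : ℝ) (a b : ℂ) : (r ^ 2 - ‖a‖ ^ 2) * (r ^ 2 - ‖b‖ ^ 2) =
    ‖(r : ℂ) ^ 2 - (starRingEnd ℂ) a * b‖ ^ 2 - r ^ 2 * ‖b - a‖ ^ 2 := by
  rw [← Complex.ofReal_pow]
  simp only [Complex.sq_norm, Complex.normSq_apply, Complex.mul_re,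
    Complex.mul_im, Complex.conj_re, Complex.conj_im, Complex.ofReal_re, Complex.ofReal_im,
    Complex.sub_re, Complex.sub_im]
  ring

/-- By the maximum principle a holomorphic function has no strict local maximum of its modulus. A
frequent inequality is enough for passing to the limit. -/
lemma frequently_norm_le {h : ℂ → ℂ} {z₀ : ℂ} (hd : ∀ᶠ z in 𝓝 z₀, DifferentiableAt ℂ h z) :
    ∃ᶠ z in 𝓝[≠] z₀, ‖h z₀‖ ≤ ‖h z‖ := by
  intro hcon
  simp only [not_le] at hcon
  have hmax : IsLocalMax (norm ∘ h) z₀ := by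
    have := eventually_nhdsWithin_iff.1 hcon
    filter_upwards [this] with z hz
    by_cases hzz : z = z₀
    · rw [hzz]
    · exact (hz hzz).le
  have heq := Complex.eventually_eq_of_isLocalMax_norm hd hmax
  obtain ⟨z, h1, h2⟩ := (hcon.and (heq.filter_mono nhdsWithin_le_nhds)).exists
  rw [h2] at h1
  exact lt_irrefl _ h1

set_option maxHeartbeats 400000 in
/-- The curvature comparison of the Ahlfors–Schwarz lemma at an interior maximum. -/
lemma deriv_bound_of_isLocalMax {ψ g k : ℂ → ℂ} {z₀ : ℂ} {r : ℝ} (hz₀ : ‖z₀‖ < r)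
    (hψ : ∀ᶠ z in 𝓝 z₀, DifferentiableAt ℂ ψ z) (hg : ∀ᶠ z in 𝓝 z₀, DifferentiableAt ℂ g z)
    (hk : ∀ᶠ z in 𝓝 z₀, DifferentiableAt ℂ k z) (hψ0 : ψ z₀ ≠ 0)
    (hmax : IsLocalMax (fun z => ‖ψ z‖ ^ 2 * (1 + ‖g z‖ ^ 2) * (1 + ‖k z‖ ^ 2) *
      (r ^ 2 - ‖z‖ ^ 2) ^ 2) z₀) :
    ‖deriv g z₀‖ ^ 2 / (1 + ‖g z₀‖ ^ 2) ^ 2 + ‖deriv k z₀‖ ^ 2 / (1 + ‖k z₀‖ ^ 2) ^ 2 ≤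
      2 * r ^ 2 / (r ^ 2 - ‖z₀‖ ^ 2) ^ 2 := by
  have hr2 : 0 < r ^ 2 - ‖z₀‖ ^ 2 := by nlinarith [norm_nonneg z₀]
  -- `G`, `K`, `D` are the holomorphic polarizations of the three real factors; the maximum
  -- principle is applied to `ψ * G * K * D ^ 2`.
  set G : ℂ → ℂ := fun z => 1 + (starRingEnd ℂ) (g z₀) * g z with hG
  set K : ℂ → ℂ := fun z => 1 + (starRingEnd ℂ) (k z₀) * k z with hK
  set D : ℂ → ℂ := fun z => (r : ℂ) ^ 2 - (starRingEnd ℂ) z₀ * z with hD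
  have hG0 : ‖G z₀‖ = 1 + ‖g z₀‖ ^ 2 := by
    rw [← abs_of_nonneg (norm_nonneg (G z₀)), ← abs_of_nonneg (by positivity : 0 ≤ 1 + ‖g z₀‖ ^ 2),
      ← sq_eq_sq_iff_abs_eq_abs, pow_two (1 + _), one_add_sq_mul_one_add_sq]
    simp [hG]
  have hK0 : ‖K z₀‖ = 1 + ‖k z₀‖ ^ 2 := by
    rw [← abs_of_nonneg (norm_nonneg (K z₀)), ← abs_of_nonneg (by positivity : 0 ≤ 1 + ‖k z₀‖ ^ 2),
      ← sq_eq_sq_iff_abs_eq_abs, pow_two (1 + _), one_add_sq_mul_one_add_sq]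
    simp [hK]
  have hD0 : ‖D z₀‖ = r ^ 2 - ‖z₀‖ ^ 2 := by
    rw [← abs_of_nonneg (norm_nonneg (D z₀)), ← abs_of_nonneg hr2.le,
      ← sq_eq_sq_iff_abs_eq_abs, pow_two (r ^ 2 - _), sq_sub_sq_mul_sq_sub_sq]
    simp [hD]
  have hgd := hg.self_of_nhds
  have hkd := hk.self_of_nhds
  have hψd := hψ.self_of_nhds
  have hGc : ContinuousAt G z₀ := by
    have := hgd.continuousAt
    simp only [hG]; fun_prop
  have hKc : ContinuousAt K z₀ := by
    have := hkd.continuousAt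
    simp only [hK]; fun_prop
  have hDc : ContinuousAt D z₀ := by simp only [hD]; fun_prop
  have hfreq := frequently_norm_le (h := fun z => ψ z * G z * K z * D z ^ 2) (z₀ := z₀) (by
    filter_upwards [hψ, hg, hk] with z h1 h2 h3
    simp only [hG, hK, hD]
    fun_prop)
  have hψne : ∀ᶠ z in 𝓝 z₀, ψ z ≠ 0 := hψd.continuousAt.eventually_ne hψ0
  have hGne : ∀ᶠ z in 𝓝 z₀, G z ≠ 0 := hGc.eventually_ne (by
    rw [← norm_pos_iff, hG0]; positivity)
  have hKne : ∀ᶠ z in 𝓝 z₀, K z ≠ 0 := hKc.eventually_ne (by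
    rw [← norm_pos_iff, hK0]; positivity)
  have hDne : ∀ᶠ z in 𝓝 z₀, D z ≠ 0 := hDc.eventually_ne (by
    rw [← norm_pos_iff, hD0]; exact hr2)
  have hball : ∀ᶠ z in 𝓝 z₀, ‖z‖ < r :=
    (continuous_norm.tendsto z₀).eventually_lt_const hz₀
  have hne : ∀ᶠ z in 𝓝[≠] z₀, z ≠ z₀ := self_mem_nhdsWithin
  have hall := (hψne.and (hGne.and (hKne.and (hDne.and (hball.and hmax))))).filter_mono
    (nhdsWithin_le_nhds (s := {z₀}ᶜ))
  have key : ∃ᶠ z in 𝓝[≠] z₀,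
      (‖slope g z₀ z‖ ^ 2 / ‖G z‖ ^ 2 + ‖slope k z₀ z‖ ^ 2 / ‖K z‖ ^ 2) *
        (1 - r ^ 2 * ‖z - z₀‖ ^ 2 / ‖D z‖ ^ 2) ^ 2 ≤ 2 * r ^ 2 / ‖D z‖ ^ 2 := by
    refine (hfreq.and_eventually (hne.and hall)).mono ?_
    rintro z ⟨hH, hzz, h1, h2, h3, h4, h5, h6⟩
    have e1 := one_add_sq_mul_one_add_sq (g z₀) (g z)
    have e2 := one_add_sq_mul_one_add_sq (k z₀) (k z)
    have e3 := sq_sub_sq_mul_sq_sub_sq r z₀ z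
    change _ = ‖G z‖ ^ 2 + _ at e1
    change _ = ‖K z‖ ^ 2 + _ at e2
    change _ = ‖D z‖ ^ 2 - _ at e3
    simp only [norm_mul, norm_pow, hG0, hK0, hD0] at hH
    have p1 := norm_pos_iff.2 h1
    have p2 := norm_pos_iff.2 h2
    have p3 := norm_pos_iff.2 h3
    have p4 := norm_pos_iff.2 h4
    have p5 : 0 < ‖z - z₀‖ := norm_pos_iff.2 (sub_ne_zero.2 hzz)
    have s1 : ‖slope g z₀ z‖ ^ 2 = ‖g z - g z₀‖ ^ 2 / ‖z - z₀‖ ^ 2 := by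
      rw [slope_def_field, norm_div, div_pow]
    have s2 : ‖slope k z₀ z‖ ^ 2 = ‖k z - k z₀‖ ^ 2 / ‖z - z₀‖ ^ 2 := by
      rw [slope_def_field, norm_div, div_pow]
    rw [s1, s2]
    set A := ‖g z - g z₀‖ ^ 2
    set B := ‖k z - k z₀‖ ^ 2
    set δ := ‖z - z₀‖ ^ 2 with hδ
    have hδ0 : 0 < δ := by positivity
    set a := A / ‖G z‖ ^ 2 with ha
    set b := B / ‖K z‖ ^ 2 with hb
    set c := r ^ 2 * δ / ‖D z‖ ^ 2 with hc
    have ha0 : 0 ≤ a := by positivity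
    have hb0 : 0 ≤ b := by positivity
    have hc0 : 0 ≤ c := by positivity
    have e1' : (1 + ‖g z₀‖ ^ 2) * (1 + ‖g z‖ ^ 2) = ‖G z‖ ^ 2 * (1 + a) := by
      rw [e1, ha]; field_simp
    have e2' : (1 + ‖k z₀‖ ^ 2) * (1 + ‖k z‖ ^ 2) = ‖K z‖ ^ 2 * (1 + b) := by
      rw [e2, hb]; field_simp
    have e3' : (r ^ 2 - ‖z₀‖ ^ 2) * (r ^ 2 - ‖z‖ ^ 2) = ‖D z‖ ^ 2 * (1 - c) := by
      rw [e3, hc]; field_simp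
    -- Local maximality and the maximum principle pull in opposite directions; only the second-order
    -- errors `a`, `b`, `c` survive. Dividing by `δ` and letting `z → z₀` gives the claim.
    have hmain : (1 + a) * (1 + b) * (1 - c) ^ 2 ≤ 1 := by
      set P := ‖ψ z‖ ^ 2 * ‖G z‖ ^ 2 * ‖K z‖ ^ 2 * (‖D z‖ ^ 2) ^ 2 with hP
      have hP0 : 0 < P := by positivity
      have hu : P * ((1 + a) * (1 + b) * (1 - c) ^ 2) ≤ P := by
        calc P * ((1 + a) * (1 + b) * (1 - c) ^ 2)
            = ‖ψ z‖ ^ 2 * (‖G z‖ ^ 2 * (1 + a)) * (‖K z‖ ^ 2 * (1 + b)) *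
              (‖D z‖ ^ 2 * (1 - c)) ^ 2 := by rw [hP]; ring
          _ = (‖ψ z‖ ^ 2 * (1 + ‖g z‖ ^ 2) * (1 + ‖k z‖ ^ 2) * (r ^ 2 - ‖z‖ ^ 2) ^ 2) *
              ((1 + ‖g z₀‖ ^ 2) * (1 + ‖k z₀‖ ^ 2) * (r ^ 2 - ‖z₀‖ ^ 2) ^ 2) := by
                rw [← e1', ← e2', ← e3']; ring
          _ ≤ (‖ψ z₀‖ ^ 2 * (1 + ‖g z₀‖ ^ 2) * (1 + ‖k z₀‖ ^ 2) * (r ^ 2 - ‖z₀‖ ^ 2) ^ 2) *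
              ((1 + ‖g z₀‖ ^ 2) * (1 + ‖k z₀‖ ^ 2) * (r ^ 2 - ‖z₀‖ ^ 2) ^ 2) := by
                gcongr
          _ = (‖ψ z₀‖ * (1 + ‖g z₀‖ ^ 2) * (1 + ‖k z₀‖ ^ 2) * (r ^ 2 - ‖z₀‖ ^ 2) ^ 2) ^ 2 := by
                ring
          _ ≤ (‖ψ z‖ * ‖G z‖ * ‖K z‖ * ‖D z‖ ^ 2) ^ 2 := by gcongr
          _ = P := by rw [hP]; ring
      exact le_of_mul_le_mul_left (by rwa [mul_one]) hP0
    have hlin : (a + b) * (1 - c) ^ 2 ≤ 2 * c := by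
      have h7 : 0 ≤ a * b * (1 - c) ^ 2 := by positivity
      have h8 : (1 + a) * (1 + b) * (1 - c) ^ 2 =
        (a + b) * (1 - c) ^ 2 + a * b * (1 - c) ^ 2 + (1 - 2 * c + c ^ 2) := by ring
      linarith [sq_nonneg c]
    have hfin : (A / δ / ‖G z‖ ^ 2 + B / δ / ‖K z‖ ^ 2) * (1 - c) ^ 2 =
        (a + b) * (1 - c) ^ 2 / δ := by
      rw [ha, hb]; field_simp
    rw [hfin, div_le_iff₀ hδ0]
    calc _ ≤ 2 * c := hlin
      _ = 2 * r ^ 2 / ‖D z‖ ^ 2 * δ := by rw [hc]; ring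
  have hsg := (hasDerivAt_iff_tendsto_slope.1 hgd.hasDerivAt).norm.pow 2
  have hsk := (hasDerivAt_iff_tendsto_slope.1 hkd.hasDerivAt).norm.pow 2
  have hGt := (hGc.tendsto.norm.pow 2).mono_left (nhdsWithin_le_nhds (s := {z₀}ᶜ))
  have hKt := (hKc.tendsto.norm.pow 2).mono_left (nhdsWithin_le_nhds (s := {z₀}ᶜ))
  have hDt := (hDc.tendsto.norm.pow 2).mono_left (nhdsWithin_le_nhds (s := {z₀}ᶜ))
  have hδt : Tendsto (fun z => r ^ 2 * ‖z - z₀‖ ^ 2) (𝓝[≠] z₀) (𝓝 0) := by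
    have : Continuous fun z => r ^ 2 * ‖z - z₀‖ ^ 2 := by fun_prop
    simpa using (this.tendsto z₀).mono_left (nhdsWithin_le_nhds (s := {z₀}ᶜ))
  rw [hG0] at hGt
  rw [hK0] at hKt
  rw [hD0] at hDt
  have hg1 : (1 + ‖g z₀‖ ^ 2) ^ 2 ≠ 0 := by positivity
  have hk1 : (1 + ‖k z₀‖ ^ 2) ^ 2 ≠ 0 := by positivity
  have hd1 : (r ^ 2 - ‖z₀‖ ^ 2) ^ 2 ≠ 0 := by positivity
  have hL := ((hsg.div hGt hg1).add (hsk.div hKt hk1)).mul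
    ((tendsto_const_nhds (x := (1 : ℝ))).sub (hδt.div hDt hd1) |>.pow 2)
  have hRt := (tendsto_const_nhds (x := 2 * r ^ 2)).div hDt hd1
  have := le_of_tendsto_of_tendsto_of_frequently hL hRt key
  simpa using this

/-- The logarithmic derivative has a primitive `h` on the disc, and `exp (h / n)` is the root. -/
lemma exists_pow_eq_of_ne_zero {f : ℂ → ℂ} {n : ℕ} (hn : n ≠ 0)
    (hf : DifferentiableOn ℂ f (ball 0 1)) (h0 : ∀ z ∈ ball (0 : ℂ) 1, f z ≠ 0) :
    ∃ g : ℂ → ℂ, DifferentiableOn ℂ g (ball 0 1) ∧ ∀ z ∈ ball (0 : ℂ) 1, g z ^ n = f z := by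
  have hd : DifferentiableOn ℂ (fun z => deriv f z / f z) (ball 0 1) :=
    (hf.deriv isOpen_ball).div hf h0
  obtain ⟨h, hh0, hh⟩ := hd.isExactOn_ball.with_val_at 0 (Complex.log (f 0))
  have hder : ∀ z ∈ ball (0 : ℂ) 1, HasDerivAt (fun z => f z * Complex.exp (-h z)) 0 z := by
    intro z hz
    have h1 := (hf.differentiableAt (isOpen_ball.mem_nhds hz)).hasDerivAt
    have h2 := h1.mul (hh z hz).neg.cexp
    have h3 : deriv f z * Complex.exp ((-h) z) +
        f z * (Complex.exp ((-h) z) * -(deriv f z / f z)) = 0 := by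
      have := h0 z hz
      field_simp
      ring
    rw [h3] at h2
    exact h2
  have hconst : ∀ z ∈ ball (0 : ℂ) 1, f z * Complex.exp (-h z) = 1 := by
    intro z hz
    have h3 := (convex_ball (0 : ℂ) 1).is_const_of_fderivWithin_eq_zero (𝕜 := ℂ)
      (f := fun z => f z * Complex.exp (-h z))
      (fun z hz => (hder z hz).differentiableAt.differentiableWithinAt)
      (fun z hz => by
        rw [fderivWithin_of_isOpen isOpen_ball hz]
        exact (hder z hz).hasFDerivAt.fderiv.trans (by ext; simp)) hz
      (mem_ball_self one_pos)
    rw [h3, hh0, Complex.exp_neg, Complex.exp_log (h0 0 (mem_ball_self one_pos))]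
    exact mul_inv_cancel₀ (h0 0 (mem_ball_self one_pos))
  refine ⟨fun z => Complex.exp (h z / n), fun z hz => ?_, fun z hz => ?_⟩
  · exact ((hh z hz).div_const _).cexp.differentiableAt.differentiableWithinAt
  · rw [← Complex.exp_nat_mul, mul_div_cancel₀ _ (Nat.cast_ne_zero.2 hn)]
    have := hconst z hz
    rw [Complex.exp_neg, ← div_eq_mul_inv, div_eq_one_iff_eq (Complex.exp_ne_zero _)] at this
    exact this.symm

/-- This bounds the curvature of the metric on the Fermat curve away from zero, with `x`, `y` the
squared moduli of the coordinates. The larger variable is at least `3 / 4`, and its fifth power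
alone suffices. -/
lemma fermat_curvature_bound {x y : ℝ} (hx : 0 ≤ x) (hy : 0 ≤ y) (h : 1 ≤ x ^ 3 + y ^ 3) :
    (1 + x) * (1 + y) ≤ 40 * (y ^ 5 / (1 + x) ^ 2 + x ^ 5 / (1 + y) ^ 2) := by
  wlog hxy : x ≤ y generalizing x y
  · have := this hy hx (by linarith) (le_of_not_ge hxy)
    linarith
  have hy3 : 3 / 4 ≤ y := by
    by_contra hlt
    push Not at hlt
    have h1 : y ^ 3 ≤ (3 / 4) ^ 3 := by gcongr
    have h2 : x ^ 3 ≤ y ^ 3 := by gcongr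
    norm_num at h1
    linarith
  have h1 : (1 + x) * (1 + y) ≤ 40 * (y ^ 5 / (1 + x) ^ 2) := by
    rw [← mul_div_assoc, le_div_iff₀ (by positivity)]
    calc (1 + x) * (1 + y) * (1 + x) ^ 2 ≤ (1 + y) * (1 + y) * (1 + y) ^ 2 := by gcongr
      _ = (1 + y) ^ 4 := by ring
      _ ≤ (7 / 3 * y) ^ 4 := by gcongr; linarith
      _ = (7 / 3) ^ 4 * y ^ 4 * 1 := by ring
      _ ≤ (7 / 3) ^ 4 * y ^ 4 * (4 / 3 * y) := by gcongr; linarith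
      _ ≤ 40 * y ^ 5 := by nlinarith [pow_nonneg hy 5]
  have h2 : 0 ≤ x ^ 5 / (1 + y) ^ 2 := by positivity
  linarith

/-- A Landau type bound for the spherical derivative of a holomorphic function that omits `0`
and `1`. -/
theorem exists_landau_bound : ∃ C > 0, ∀ f : ℂ → ℂ, DifferentiableOn ℂ f (ball 0 1) →
    (∀ z ∈ ball (0 : ℂ) 1, f z ≠ 0 ∧ f z ≠ 1) →
    ∀ z ∈ ball (0 : ℂ) (1 / 2), ‖deriv f z‖ ≤ C * (1 + ‖f z‖ ^ 2) := by
  refine ⟨200, by norm_num, fun f hf h01 w hw => ?_⟩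
  obtain ⟨g, hg, hgf⟩ := exists_pow_eq_of_ne_zero (n := 6) (by norm_num) hf fun z hz => (h01 z hz).1
  obtain ⟨k, hk, hkf⟩ := exists_pow_eq_of_ne_zero (n := 6) (f := fun z => 1 - f z) (by norm_num)
    (by fun_prop) fun z hz => sub_ne_zero.2 (h01 z hz).2.symm
  have hg0 : ∀ z ∈ ball (0 : ℂ) 1, g z ≠ 0 := fun z hz h => (h01 z hz).1 (by
    rw [← hgf z hz, h]; simp)
  have hk0 : ∀ z ∈ ball (0 : ℂ) 1, k z ≠ 0 := fun z hz h => (h01 z hz).2 (by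
    have := hkf z hz
    rw [h, zero_pow (by norm_num)] at this
    exact (sub_eq_zero.1 this.symm).symm)
  -- Up to the factor `6`, `ψ dz` is the pullback of the form `dx / y^5` on the Fermat curve. The
  -- density `u` below is the sum of the squared moduli of its products with `1`, `x`, `y`, `xy`.
  set ψ : ℂ → ℂ := fun z => deriv f z / (g z ^ 5 * k z ^ 5) with hψ
  have hψd : DifferentiableOn ℂ ψ (ball 0 1) :=
    (hf.deriv isOpen_ball).div ((hg.pow 5).mul (hk.pow 5)) fun z hz =>
      mul_ne_zero (pow_ne_zero _ (hg0 z hz)) (pow_ne_zero _ (hk0 z hz))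
  set u : ℂ → ℝ := fun z => ‖ψ z‖ ^ 2 * (1 + ‖g z‖ ^ 2) * (1 + ‖k z‖ ^ 2) with hu
  have hf' : ∀ z ∈ ball (0 : ℂ) 1, deriv f z = ψ z * (g z ^ 5 * k z ^ 5) := fun z hz => by
    have := hg0 z hz
    have := hk0 z hz
    simp only [hψ]
    field_simp
  have hg' : ∀ z ∈ ball (0 : ℂ) 1, deriv g z = ψ z * k z ^ 5 / 6 := fun z hz => by
    have hn := isOpen_ball.mem_nhds hz
    have h1 : deriv f z = deriv (fun z => g z ^ 6) z := by
      apply Filter.EventuallyEq.deriv_eq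
      filter_upwards [hn] with y hy using (hgf y hy).symm
    have h2 := ((hg.differentiableAt hn).hasDerivAt.pow 6).deriv
    have h3 : deriv f z = ((6 : ℕ) : ℂ) * g z ^ 5 * deriv g z := h1.trans h2
    have h4 := hg0 z hz
    have h5 : g z ^ 5 * deriv g z = g z ^ 5 * (ψ z * k z ^ 5 / 6) := by
      rw [hf' z hz] at h3
      push_cast at h3
      linear_combination -h3 / 6
    exact mul_left_cancel₀ (pow_ne_zero 5 h4) h5
  have hk' : ∀ z ∈ ball (0 : ℂ) 1, deriv k z = -(ψ z * g z ^ 5 / 6) := fun z hz => by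
    have hn := isOpen_ball.mem_nhds hz
    have h1 : deriv (fun z => 1 - f z) z = deriv (fun z => k z ^ 6) z := by
      apply Filter.EventuallyEq.deriv_eq
      filter_upwards [hn] with y hy using (hkf y hy).symm
    have h2 := ((hk.differentiableAt hn).hasDerivAt.pow 6).deriv
    have h3 : -deriv f z = ((6 : ℕ) : ℂ) * k z ^ 5 * deriv k z := by
      rw [← h2.symm.trans (rfl : _ = deriv (fun z => k z ^ 6) z) |>.symm, ← h1, deriv_const_sub]
    have h4 := hk0 z hz
    have h5 : k z ^ 5 * deriv k z = k z ^ 5 * -(ψ z * g z ^ 5 / 6) := by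
      rw [hf' z hz] at h3
      push_cast at h3
      linear_combination -h3 / 6
    exact mul_left_cancel₀ (pow_ne_zero 5 h4) h5
  have hsub : closedBall (0 : ℂ) (3 / 4) ⊆ ball 0 1 := closedBall_subset_ball (by norm_num)
  have hcont : ContinuousOn (fun z => u z * ((3 / 4 : ℝ) ^ 2 - ‖z‖ ^ 2) ^ 2)
      (closedBall 0 (3 / 4)) := by
    have h1 := hψd.continuousOn.mono hsub
    have h2 := hg.continuousOn.mono hsub
    have h3 := hk.continuousOn.mono hsub
    simp only [hu]
    fun_prop
  obtain ⟨z₀, hz₀, hmax⟩ := (isCompact_closedBall (0 : ℂ) (3 / 4)).exists_isMaxOn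
    ⟨0, mem_closedBall_self (by norm_num)⟩ hcont
  have hu0 : ∀ z, 0 ≤ u z := fun z => by simp only [hu]; positivity
  -- The `36` comes from the factor `1 / 6` in `g'` and `k'`, the `40` from
  -- `fermat_curvature_bound`, the rest from `deriv_bound_of_isLocalMax`.
  have hbound : u z₀ * ((3 / 4 : ℝ) ^ 2 - ‖z₀‖ ^ 2) ^ 2 ≤ 36 * 40 * (2 * (3 / 4) ^ 2) := by
    by_cases hzero : u z₀ * ((3 / 4 : ℝ) ^ 2 - ‖z₀‖ ^ 2) ^ 2 = 0
    · rw [hzero]; positivity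
    have hψ0 : ψ z₀ ≠ 0 := fun h => hzero (by simp [hu, h])
    have hlt : ‖z₀‖ < 3 / 4 := by
      refine lt_of_le_of_ne (mem_closedBall_zero_iff.1 hz₀) fun h => hzero (by simp [h])
    have hr2 : 0 < (3 / 4 : ℝ) ^ 2 - ‖z₀‖ ^ 2 := by nlinarith [norm_nonneg z₀]
    have hn := isOpen_ball.mem_nhds (hsub hz₀)
    have hb := deriv_bound_of_isLocalMax (r := 3 / 4) hlt
      (hψd.eventually_differentiableAt hn) (hg.eventually_differentiableAt hn)
      (hk.eventually_differentiableAt hn) hψ0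
      (hmax.isLocalMax (closedBall_mem_nhds_of_mem (by simpa using hlt)))
    rw [hg' z₀ (hsub hz₀), hk' z₀ (hsub hz₀)] at hb
    simp only [norm_neg, norm_div, norm_mul, norm_pow, Complex.norm_ofNat] at hb
    have hx : (1 : ℝ) ≤ (‖g z₀‖ ^ 2) ^ 3 + (‖k z₀‖ ^ 2) ^ 3 := by
      have e : g z₀ ^ 6 + k z₀ ^ 6 = 1 := by
        rw [hgf z₀ (hsub hz₀), hkf z₀ (hsub hz₀)]; ring
      calc (1 : ℝ) = ‖g z₀ ^ 6 + k z₀ ^ 6‖ := by rw [e, norm_one]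
        _ ≤ ‖g z₀‖ ^ 6 + ‖k z₀‖ ^ 6 := by
          rw [← norm_pow, ← norm_pow]; exact norm_add_le _ _
        _ = _ := by ring
    have hcurv := fermat_curvature_bound (sq_nonneg ‖g z₀‖) (sq_nonneg ‖k z₀‖) hx
    rw [le_div_iff₀ (by positivity)] at hb
    refine le_trans ?_ (mul_le_mul_of_nonneg_left hb (by norm_num : (0 : ℝ) ≤ 36 * 40))
    rw [← mul_assoc]
    gcongr
    calc u z₀ = ‖ψ z₀‖ ^ 2 * ((1 + ‖g z₀‖ ^ 2) * (1 + ‖k z₀‖ ^ 2)) := by simp only [hu]; ring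
      _ ≤ ‖ψ z₀‖ ^ 2 * (40 * ((‖k z₀‖ ^ 2) ^ 5 / (1 + ‖g z₀‖ ^ 2) ^ 2 +
          (‖g z₀‖ ^ 2) ^ 5 / (1 + ‖k z₀‖ ^ 2) ^ 2)) := by gcongr
      _ = _ := by ring
  have hw' : ‖w‖ < 1 / 2 := mem_ball_zero_iff.1 hw
  have hwc : w ∈ closedBall (0 : ℂ) (3 / 4) := mem_closedBall_zero_iff.2 (by linarith)
  have huw : u w ≤ 16589 := by
    have h1 := (hmax hwc).trans hbound
    simp only at h1
    have h2 : (5 / 16 : ℝ) ≤ (3 / 4 : ℝ) ^ 2 - ‖w‖ ^ 2 := by nlinarith [norm_nonneg w]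
    have h3 : u w * (5 / 16 : ℝ) ^ 2 ≤ 36 * 40 * (2 * (3 / 4) ^ 2) :=
      le_trans (mul_le_mul_of_nonneg_left (by gcongr) (hu0 w)) h1
    norm_num at h3
    linarith
  have hwb := hsub hwc
  have hxy : (‖k w‖ ^ 6) ≤ 1 + ‖g w‖ ^ 6 := by
    have e : k w ^ 6 = 1 - g w ^ 6 := by rw [hgf w hwb, hkf w hwb]
    rw [← norm_pow, e]
    exact (norm_sub_le _ _).trans (by simp)
  have hfw : ‖f w‖ = ‖g w‖ ^ 6 := by rw [← hgf w hwb, norm_pow]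
  have hsq : ‖deriv f w‖ ^ 2 ≤ (200 * (1 + ‖f w‖ ^ 2)) ^ 2 := by
    rw [hf' w hwb, hfw]
    simp only [norm_mul, norm_pow]
    set X := ‖g w‖ ^ 6 with hX
    have hX0 : 0 ≤ X := by positivity
    have h1 : ((‖g w‖ * ‖k w‖) ^ 2) ^ 5 ≤ 2 * (1 + X ^ 2) ^ 2 := by
      have h2 : ((‖g w‖ * ‖k w‖) ^ 2) ^ 5 ≤ 1 + ((‖g w‖ * ‖k w‖) ^ 2) ^ 6 := by
        set t := (‖g w‖ * ‖k w‖) ^ 2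
        have ht : 0 ≤ t := by positivity
        rcases le_total t 1 with h | h
        · have := pow_le_one₀ (n := 5) ht h
          have := pow_nonneg ht 6
          linarith
        · have := pow_le_pow_right₀ h (by norm_num : 5 ≤ 6)
          linarith
      have h3 : ((‖g w‖ * ‖k w‖) ^ 2) ^ 6 = X ^ 2 * (‖k w‖ ^ 6) ^ 2 := by rw [hX]; ring
      have h4 : (‖k w‖ ^ 6) ^ 2 ≤ (1 + X) ^ 2 := by gcongr
      have h5 : X ^ 2 * (‖k w‖ ^ 6) ^ 2 ≤ X ^ 2 * (1 + X) ^ 2 := by gcongr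
      nlinarith [sq_nonneg (X ^ 2 - X), sq_nonneg (X - 1)]
    have h6 : ‖ψ w‖ ^ 2 ≤ 16589 := by
      refine le_trans ?_ huw
      simp only [hu]
      have h7 : (1 : ℝ) ≤ 1 + ‖g w‖ ^ 2 := by linarith [sq_nonneg ‖g w‖]
      have h8 : (1 : ℝ) ≤ 1 + ‖k w‖ ^ 2 := by linarith [sq_nonneg ‖k w‖]
      calc ‖ψ w‖ ^ 2 = ‖ψ w‖ ^ 2 * 1 * 1 := by ring
        _ ≤ _ := by gcongr
    calc (‖ψ w‖ * (‖g w‖ ^ 5 * ‖k w‖ ^ 5)) ^ 2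
        = ‖ψ w‖ ^ 2 * ((‖g w‖ * ‖k w‖) ^ 2) ^ 5 := by ring
      _ ≤ 16589 * (2 * (1 + X ^ 2) ^ 2) := by gcongr
      _ ≤ (200 * (1 + X ^ 2)) ^ 2 := by nlinarith [sq_nonneg (1 + X ^ 2)]
  exact le_of_sq_le_sq hsq (by positivity)

/-- The chordal distance of the values is controlled by the spherical derivative. -/
lemma dist_le_of_deriv_bound {f : ℂ → ℂ} {s : Set ℂ} (hs : IsOpen s) (hconv : Convex ℝ s)
    (hf : DifferentiableOn ℂ f s) {C : ℝ} (hC : 0 < C)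
    (hb : ∀ z ∈ s, ‖deriv f z‖ ≤ C * (1 + ‖f z‖ ^ 2)) {a b : ℂ} (ha : a ∈ s) (hbs : b ∈ s) :
    dist (f b : Sphere) (f a : Sphere) ≤ 3 * C * ‖b - a‖ := by
  rcases eq_or_ne b a with rfl | hab
  · simp
  have hab' : 0 < ‖b - a‖ := norm_pos_iff.2 (sub_ne_zero.2 hab)
  set γ : ℝ → ℂ := fun t => a + t * (b - a) with hγ
  have hγs : ∀ t ∈ Icc (0 : ℝ) 1, γ t ∈ s := fun t ht => by
    have := hconv.add_smul_sub_mem ha hbs ht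
    simpa [hγ] using this
  have hγd : ∀ t, HasDerivAt γ (b - a) t := fun t => by
    have := ((Complex.ofRealCLM.hasDerivAt (x := t)).mul_const (b - a)).const_add a
    rw [Complex.ofRealCLM_apply, Complex.ofReal_one, one_mul] at this
    exact this
  have hFd : ∀ t ∈ Icc (0 : ℝ) 1, HasDerivAt (fun t => f (γ t)) (deriv f (γ t) * (b - a)) t :=
    fun t ht => by
      have h1 := (hf.differentiableAt (hs.mem_nhds (hγs t ht))).hasDerivAt
      exact h1.comp t (hγd t)
  set q : ℝ → Sphere := fun t => ((f (γ t) : ℂ) : Sphere) with hq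
  have hqc : ∀ t ∈ Icc (0 : ℝ) 1, ContinuousAt q t := fun t ht =>
    (OnePoint.continuous_coe.continuousAt).comp (hFd t ht).continuousAt
  -- The chordal speed is at most `2 * C * ‖b - a‖`; the comparison needs a strict inequality, hence
  -- the `3`.
  have := image_le_of_liminf_slope_right_lt_deriv_boundary (f := fun t => dist (q t) (q 0))
    (f' := fun _ => 2 * C * ‖b - a‖) (a := 0) (b := 1) (B := fun t => 3 * C * ‖b - a‖ * t)
    (B' := fun _ => 3 * C * ‖b - a‖)
    (fun t ht => ContinuousAt.continuousWithinAt
      (Filter.Tendsto.dist (hqc t ht) tendsto_const_nhds))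
    (by
      intro t ht r hr
      have htI : t ∈ Icc (0 : ℝ) 1 := ⟨ht.1, ht.2.le⟩
      apply Eventually.frequently
      have hslope := ((hasDerivAt_iff_tendsto_slope.1 (hFd t htI)).mono_left
        (nhdsGT_le_nhdsNE t)).norm
      have hFc : Tendsto (fun t => f (γ t)) (𝓝[>] t) (𝓝 (f (γ t))) :=
        (hFd t htI).continuousAt.tendsto.mono_left nhdsWithin_le_nhds
      have hden : Tendsto (fun y => Real.sqrt (1 + ‖f (γ y)‖ ^ 2) *
          Real.sqrt (1 + ‖f (γ t)‖ ^ 2)) (𝓝[>] t) (𝓝 (1 + ‖f (γ t)‖ ^ 2)) := by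
        have h1 := (((hFc.norm.pow 2).const_add 1).sqrt).mul_const (Real.sqrt (1 + ‖f (γ t)‖ ^ 2))
        rwa [Real.mul_self_sqrt (by positivity)] at h1
      have hlim := (hslope.const_mul 2).div hden (by positivity)
      have hlt : 2 * ‖deriv f (γ t) * (b - a)‖ / (1 + ‖f (γ t)‖ ^ 2) < r := by
        refine lt_of_le_of_lt ?_ hr
        rw [div_le_iff₀ (by positivity), norm_mul]
        calc 2 * (‖deriv f (γ t)‖ * ‖b - a‖)
            ≤ 2 * ((C * (1 + ‖f (γ t)‖ ^ 2)) * ‖b - a‖) := by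
              gcongr; exact hb _ (hγs t htI)
          _ = _ := by ring
      filter_upwards [hlim.eventually_lt_const hlt, self_mem_nhdsWithin] with y hy hty
      have hty : 0 < y - t := sub_pos.2 hty
      refine lt_of_le_of_lt ?_ hy
      rw [slope_def_field, div_le_iff₀ hty]
      have h1 : dist (q y) (q 0) - dist (q t) (q 0) ≤ dist (q y) (q t) := by
        linarith [dist_triangle (q y) (q t) (q 0)]
      refine h1.trans (le_of_eq ?_)
      simp only [Pi.div_apply, slope, vsub_eq_sub, norm_smul, norm_inv,
        Real.norm_of_nonneg hty.le]
      rw [dist_eq_chordalDist, chordalDist_coe_coe]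
      field_simp)
    (by simp) (fun t => by simpa using (hasDerivAt_id t).const_mul (3 * C * ‖b - a‖))
    (by
      intro t _ _
      have : 0 < C * ‖b - a‖ := by positivity
      linarith) (right_mem_Icc.2 zero_le_one)
  simpa [hq, hγ] using this

/-! ### Iterates of different degrees are antipodal somewhere. -/

/-- The Hermitian product of two vectors of `ℂ²`. -/
def herm (u v : ℂ × ℂ) : ℂ := u.1 * (starRingEnd ℂ) v.1 + u.2 * (starRingEnd ℂ) v.2

lemma norm_herm_sq_add_norm_wedge_sq (u v : ℂ × ℂ) :
    ‖herm u v‖ ^ 2 + ‖wedge u v‖ ^ 2 = hnorm u ^ 2 * hnorm v ^ 2 := by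
  rw [hnorm_sq, hnorm_sq, herm, wedge]
  simp only [Complex.sq_norm, Complex.normSq_apply, Complex.add_re, Complex.add_im, Complex.mul_re,
    Complex.mul_im, Complex.conj_re, Complex.conj_im, Complex.sub_re, Complex.sub_im]
  ring

lemma norm_wedge_le (u v : ℂ × ℂ) : ‖wedge u v‖ ≤ hnorm u * hnorm v := by
  refine le_of_sq_le_sq ?_ (mul_nonneg (hnorm_nonneg u) (hnorm_nonneg v))
  rw [mul_pow, ← norm_herm_sq_add_norm_wedge_sq]
  exact le_add_of_nonneg_left (sq_nonneg _)

lemma herm_ne_zero_of_dist_ne_two {u v : ℂ × ℂ} (hu : u ≠ 0) (hv : v ≠ 0)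
    (h : dist (toSphere u) (toSphere v) ≠ 2) : herm u v ≠ 0 := by
  intro h0
  have h1 := norm_herm_sq_add_norm_wedge_sq u v
  have hu' := hnorm_pos hu
  have hv' := hnorm_pos hv
  rw [h0, norm_zero, zero_pow two_ne_zero, zero_add, ← mul_pow] at h1
  have h2 : ‖wedge u v‖ = hnorm u * hnorm v :=
    (pow_left_inj₀ (norm_nonneg _) (by positivity) two_ne_zero).1 h1
  apply h
  rw [dist_toSphere hu hv, h2]
  field_simp

/-- A continuous nonvanishing function on the plane has winding number zero on the unit circle. -/
lemma eq_of_nonvanishing_extension {Ψ : ℂ → ℂ} (hc : Continuous Ψ) (h0 : ∀ z, Ψ z ≠ 0)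
    {a b : ℕ} {c : ℂ} (h : ∀ z, ‖z‖ = 1 → Ψ z = z ^ a * (starRingEnd ℂ) z ^ b * c) : a = b := by
  obtain ⟨L, ⟨-, hL⟩, -⟩ := Complex.isCoveringMapOn_exp.existsUnique_continuousMap_lifts
    (⟨Ψ, hc⟩ : C(ℂ, ℂ)) (Complex.exp_log (h0 0)) h0
  have hL' : ∀ z, Complex.exp (L z) = Ψ z := fun z => congrFun hL z
  -- `L` is a global logarithm of `Ψ`. Since `exp ∘ φ` is constant, so is `φ`; comparing `0` with
  -- `2π` forces `a = b`.
  set φ : ℝ → ℂ := fun θ => L (Complex.exp (θ * Complex.I)) - ((a : ℂ) - b) * (θ * Complex.I) with hφ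
  have hφc : Continuous φ := by
    have := L.continuous
    simp only [hφ]
    fun_prop
  have hexp : ∀ θ, Complex.exp (φ θ) = c := by
    intro θ
    have h1 : ‖Complex.exp (θ * Complex.I)‖ = 1 := Complex.norm_exp_ofReal_mul_I θ
    simp only [hφ]
    rw [Complex.exp_sub, hL', h _ h1, ← Complex.exp_conj, ← Complex.exp_nat_mul,
      ← Complex.exp_nat_mul, div_eq_iff (Complex.exp_ne_zero _), ← Complex.exp_add, mul_comm]
    congr 2
    simp only [map_mul, Complex.conj_ofReal, Complex.conj_I]
    ring
  have hconst : φ = fun _ => φ 0 :=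
    Complex.isCoveringMap_exp.eq_of_comp_eq hφc continuous_const
      (funext fun θ => Subtype.ext ((hexp θ).trans (hexp 0).symm)) 0 rfl
  have h2 := congrFun hconst (2 * Real.pi)
  simp only [hφ] at h2
  push_cast at h2
  rw [Complex.exp_two_pi_mul_I, zero_mul, Complex.exp_zero, mul_zero, sub_zero,
    sub_eq_self] at h2
  have h3 := (mul_eq_zero.1 h2).resolve_right Complex.two_pi_I_ne_zero
  exact_mod_cast sub_eq_zero.1 h3

/-- Two iterates of different orders take antipodal values somewhere, since their degrees differ. -/
theorem exists_dist_iterates_eq_two {R : RatFunc ℂ} (hR : 2 ≤ ratDegree R) {m n : ℕ} (hmn : m ≠ n) :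
    ∃ p, dist ((ratMap R)^[m] p) ((ratMap R)^[n] p) = 2 := by
  by_contra! hcon
  have hherm : ∀ v : ℂ × ℂ, v ≠ 0 → herm ((homLift R)^[m] v) ((homLift R)^[n] v) ≠ 0 := by
    intro v hv
    refine herm_ne_zero_of_dist_ne_two (homLift_iterate_ne_zero R m hv)
      (homLift_iterate_ne_zero R n hv) ?_
    rw [toSphere_homLift_iterate R m hv, toSphere_homLift_iterate R n hv]
    exact hcon _
  -- This map of the plane into `ℂ² ∖ 0` equals `z • (1, 0)` on the unit circle, where homogeneity
  -- makes the Hermitian product a monomial in `z` and its conjugate.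
  have hv : ∀ z : ℂ, ((z, ((1 - ‖z‖ : ℝ) : ℂ)) : ℂ × ℂ) ≠ 0 := by
    intro z hz
    rw [Prod.mk_eq_zero] at hz
    simp [hz.1] at hz
  refine hmn (Nat.pow_right_injective hR ?_)
  refine eq_of_nonvanishing_extension
    (Ψ := fun z => herm ((homLift R)^[m] (z, ((1 - ‖z‖ : ℝ) : ℂ)))
      ((homLift R)^[n] (z, ((1 - ‖z‖ : ℝ) : ℂ))))
    (c := herm ((homLift R)^[m] (1, 0)) ((homLift R)^[n] (1, 0))) ?_ (fun z => hherm _ (hv z)) ?_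
  · have h1 : Continuous fun z : ℂ => ((z, ((1 - ‖z‖ : ℝ) : ℂ)) : ℂ × ℂ) :=
      continuous_id.prodMk (Complex.continuous_ofReal.comp (by fun_prop))
    have h2 := ((continuous_homLift R).iterate m).comp h1
    have h3 := ((continuous_homLift R).iterate n).comp h1
    simp only [Function.comp_def] at h2 h3
    unfold herm
    fun_prop
  · intro z hz
    have e : ((z, ((1 - ‖z‖ : ℝ) : ℂ)) : ℂ × ℂ) = z • ((1, 0) : ℂ × ℂ) := by simp [hz]
    simp only [e, homLift_iterate_smul]
    simp only [herm, Prod.smul_fst, Prod.smul_snd, smul_eq_mul, map_mul, map_pow]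
    ring

/-! ### Uniform normality and nonemptiness of the Julia set. -/

/-- Every sequence of the family has a subsequence that converges uniformly on `S`. -/
def UniformlyNormalOn (𝓕 : Set (Sphere → Sphere)) (S : Set Sphere) : Prop :=
  ∀ f : ℕ → Sphere → Sphere, (∀ n, f n ∈ 𝓕) → ∃ φ : ℕ → ℕ, StrictMono φ ∧
    ∃ g : Sphere → Sphere, ∀ ε > 0, ∃ N, ∀ n ≥ N, ∀ z ∈ S, dist (f (φ n) z) (g z) < ε

-- Two successive extractions suffice, and the limits may be glued arbitrarily since no continuity
-- is asked of them. This lets local normality spread over the compact sphere.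
open scoped Classical in
lemma UniformlyNormalOn.union {𝓕 : Set (Sphere → Sphere)} {S T : Set Sphere}
    (hS : UniformlyNormalOn 𝓕 S) (hT : UniformlyNormalOn 𝓕 T) : UniformlyNormalOn 𝓕 (S ∪ T) := by
  intro f hf
  obtain ⟨φ, hφ, g, hg⟩ := hS f hf
  obtain ⟨φ', hφ', g', hg'⟩ := hT (fun n => f (φ n)) fun n => hf _
  refine ⟨φ ∘ φ', hφ.comp hφ', fun z => if z ∈ S then g z else g' z, fun ε hε => ?_⟩
  obtain ⟨N, hN⟩ := hg ε hε
  obtain ⟨N', hN'⟩ := hg' ε hε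
  refine ⟨max N N', fun n hn z hz => ?_⟩
  by_cases hzS : z ∈ S
  · simp only [hzS, if_true]
    exact hN _ ((le_of_max_le_left hn).trans (hφ'.id_le n)) z hzS
  · simp only [hzS, if_false]
    exact hN' n (le_of_max_le_right hn) z (hz.resolve_left hzS)

lemma UniformlyNormalOn.mono {𝓕 : Set (Sphere → Sphere)} {S T : Set Sphere}
    (hT : UniformlyNormalOn 𝓕 T) (h : S ⊆ T) : UniformlyNormalOn 𝓕 S := by
  intro f hf
  obtain ⟨φ, hφ, g, hg⟩ := hT f hf
  refine ⟨φ, hφ, g, fun ε hε => ?_⟩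
  obtain ⟨N, hN⟩ := hg ε hε
  exact ⟨N, fun n hn z hz => hN n hn z (h hz)⟩

lemma UniformlyNormalOn.isNormalFamilyOn {𝓕 : Set (Sphere → Sphere)} {U : Set Sphere}
    (h : UniformlyNormalOn 𝓕 U) : IsNormalFamilyOn 𝓕 U := by
  intro f hf
  obtain ⟨φ, hφ, g, hg⟩ := h f hf
  refine ⟨φ, hφ, g, fun K _ hKU ε hε => ?_⟩
  obtain ⟨N, hN⟩ := hg ε hε
  exact ⟨N, fun n hn z hz => by rw [← dist_eq_chordalDist]; exact hN n hn z (hKU hz)⟩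

lemma IsNormalFamilyOn.uniformlyNormalOn {𝓕 : Set (Sphere → Sphere)} {U K : Set Sphere}
    (h : IsNormalFamilyOn 𝓕 U) (hK : IsCompact K) (hKU : K ⊆ U) : UniformlyNormalOn 𝓕 K := by
  intro f hf
  obtain ⟨φ, hφ, g, hg⟩ := h f hf
  refine ⟨φ, hφ, g, fun ε hε => ?_⟩
  obtain ⟨N, hN⟩ := hg K hK hKU ε hε
  exact ⟨N, fun n hn z hz => by rw [dist_eq_chordalDist]; exact hN n hn z hz⟩

theorem juliaSet_nonempty {R : RatFunc ℂ} (hR : 2 ≤ ratDegree R) : (juliaSet R).Nonempty := by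
  rw [nonempty_iff_ne_empty]
  intro hJ
  have hF : ∀ z, z ∈ fatouSet R := fun z => by
    by_contra hz
    have : z ∈ juliaSet R := hz
    rw [hJ] at this
    exact this
  have hN : UniformlyNormalOn (iterates R) univ := by
    refine isCompact_univ.induction_on (p := UniformlyNormalOn (iterates R)) ?_
      (fun s t hst ht => ht.mono hst) (fun s t hs ht => hs.union ht) fun z _ => ?_
    · intro f _
      exact ⟨id, strictMono_id, id, fun ε _ => ⟨0, fun n _ z hz => hz.elim⟩⟩
    · obtain ⟨U, hU, hzU, hN⟩ := hF z
      obtain ⟨K, hK, hzK, hKU⟩ := exists_compact_subset hU hzU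
      exact ⟨K, mem_nhdsWithin_of_mem_nhds (mem_interior_iff_mem_nhds.1 hzK),
        hN.uniformlyNormalOn hK hKU⟩
  obtain ⟨φ, hφ, g, hg⟩ := hN (fun n => (ratMap R)^[n + 1]) fun n => ⟨n + 1, n.succ_pos, rfl⟩
  -- Half of the antipodal distance `2`: two late terms are then nowhere antipodal.
  obtain ⟨N, hN⟩ := hg 1 one_pos
  have hne : φ N + 1 ≠ φ (N + 1) + 1 := by
    have : φ N < φ (N + 1) := hφ N.lt_succ_self
    omega
  obtain ⟨p, hp⟩ := exists_dist_iterates_eq_two hR hne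
  have h1 := hN N le_rfl p (mem_univ p)
  have h2 := hN (N + 1) N.le_succ p (mem_univ p)
  have h3 := dist_triangle_right ((ratMap R)^[φ N + 1] p) ((ratMap R)^[φ (N + 1) + 1] p) (g p)
  linarith

/-! ### Montel's theorem. -/

lemma exists_subseq_of_lipschitz {q : ℕ → ℂ → Sphere} {C ρ : ℝ}
    (hq : ∀ n, ∀ s ∈ closedBall (0 : ℂ) ρ, ∀ t ∈ closedBall (0 : ℂ) ρ,
      dist (q n s) (q n t) ≤ C * dist s t) :
    ∃ φ : ℕ → ℕ, StrictMono φ ∧ ∃ G : ℂ → Sphere, ∀ ε > 0, ∃ N, ∀ n ≥ N,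
      ∀ t ∈ closedBall (0 : ℂ) ρ, dist (q (φ n) t) (G t) < ε := by
  classical
  have : CompactSpace (closedBall (0 : ℂ) ρ) :=
    isCompact_iff_compactSpace.1 (isCompact_closedBall 0 ρ)
  have hb : Tendsto (fun x => C * x) (𝓝 0) (𝓝 0) := by
    have : Continuous fun x : ℝ => C * x := by fun_prop
    simpa using this.tendsto 0
  have hcont : ∀ n, Continuous fun t : closedBall (0 : ℂ) ρ => q n t := by
    intro n
    rw [continuous_iff_continuousAt]
    intro t
    rw [ContinuousAt, tendsto_iff_dist_tendsto_zero]
    refine squeeze_zero (fun _ => dist_nonneg) (fun s => hq n s s.2 t t.2) ?_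
    have : Continuous fun s : closedBall (0 : ℂ) ρ => C * dist (s : ℂ) (t : ℂ) := by fun_prop
    simpa using this.tendsto t
  set F : ℕ → BoundedContinuousFunction (closedBall (0 : ℂ) ρ) Sphere :=
    fun n => BoundedContinuousFunction.mkOfCompact ⟨fun t => q n t, hcont n⟩ with hF
  have hcomp := BoundedContinuousFunction.arzela_ascoli univ isCompact_univ (range F)
    (fun _ _ _ => mem_univ _)
    (Metric.uniformEquicontinuous_of_continuity_modulus (fun x => C * x) hb _ (by
      rintro s t ⟨_, n, rfl⟩
      exact hq n s s.2 t t.2)).equicontinuous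
  obtain ⟨g, -, φ, hφ, hlim⟩ := hcomp.tendsto_subseq fun n => subset_closure (mem_range_self n)
  refine ⟨φ, hφ, fun t => if h : t ∈ closedBall (0 : ℂ) ρ then g ⟨t, h⟩ else OnePoint.infty,
    fun ε hε => ?_⟩
  obtain ⟨N, hN⟩ := Metric.tendsto_atTop.1 hlim ε hε
  refine ⟨N, fun n hn t ht => ?_⟩
  simp only [ht, dif_pos]
  exact (BoundedContinuousFunction.dist_coe_le_dist (f := F (φ n)) ⟨t, ht⟩).trans_lt (hN n hn)

lemma differentiable_homLift (R : RatFunc ℂ) : Differentiable ℂ (homLift R) := by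
  unfold homLift homEval
  fun_prop

lemma wedge_plucker (α β v w : ℂ × ℂ) :
    wedge v α * wedge w β - wedge v β * wedge w α = wedge v w * wedge α β := by
  unfold wedge; ring

lemma wedge_ne_zero {v w : ℂ × ℂ} (hv : v ≠ 0) (hw : w ≠ 0) (h : toSphere v ≠ toSphere w) :
    wedge v w ≠ 0 := fun h0 => h ((toSphere_eq_iff hv hw).2 h0)

/-- The Möbius transformation taking three given points to `0`, `∞`, `1`, in homogeneous
coordinates. -/
def moebius (α β γ v : ℂ × ℂ) : ℂ × ℂ := (wedge v α * wedge γ β, wedge v β * wedge γ α)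

/-- A linear map multiplies `wedge` by a constant, so for this direction only an upper bound for its
effect on `hnorm` is needed. -/
lemma exists_dist_le_moebius {α β γ : ℂ × ℂ} (h1 : wedge α β ≠ 0) (h2 : wedge γ α ≠ 0)
    (h3 : wedge γ β ≠ 0) : ∃ K > 0, ∀ v w, v ≠ 0 → w ≠ 0 → moebius α β γ v ≠ 0 →
      moebius α β γ w ≠ 0 → dist (toSphere v) (toSphere w) ≤
        K * dist (toSphere (moebius α β γ v)) (toSphere (moebius α β γ w)) := by
  set κ := ‖wedge γ β‖ * ‖wedge γ α‖ * ‖wedge α β‖ with hκ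
  have hκ0 : 0 < κ := by positivity
  set L := hnorm α * ‖wedge γ β‖ + hnorm β * ‖wedge γ α‖ with hL
  have hα : α ≠ 0 := fun h => h1 (by simp [h, wedge])
  have hα' := hnorm_pos hα
  have hβ' := hnorm_nonneg β
  have hL0 : 0 < L := by positivity
  have hM : ∀ v, hnorm (moebius α β γ v) ≤ L * hnorm v := by
    intro v
    have hv := hnorm_nonneg v
    have e1 : ‖(moebius α β γ v).1‖ ≤ hnorm v * hnorm α * ‖wedge γ β‖ := by
      simp only [moebius, norm_mul]; gcongr; exact norm_wedge_le v α
    have e2 : ‖(moebius α β γ v).2‖ ≤ hnorm v * hnorm β * ‖wedge γ α‖ := by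
      simp only [moebius, norm_mul]; gcongr; exact norm_wedge_le v β
    refine le_of_sq_le_sq ?_ (by positivity)
    rw [hnorm_sq]
    calc _ ≤ (hnorm v * hnorm α * ‖wedge γ β‖) ^ 2 + (hnorm v * hnorm β * ‖wedge γ α‖) ^ 2 := by
          gcongr
      _ ≤ (hnorm v * hnorm α * ‖wedge γ β‖ + hnorm v * hnorm β * ‖wedge γ α‖) ^ 2 := by
          have : 0 ≤ (hnorm v * hnorm α * ‖wedge γ β‖) * (hnorm v * hnorm β * ‖wedge γ α‖) := by
            positivity
          linarith [add_sq (hnorm v * hnorm α * ‖wedge γ β‖) (hnorm v * hnorm β * ‖wedge γ α‖)]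
      _ = _ := by rw [hL]; ring
  refine ⟨L ^ 2 / κ, by positivity, fun v w hv hw hv' hw' => ?_⟩
  rw [dist_toSphere hv hw, dist_toSphere hv' hw']
  have pv := hnorm_pos hv
  have pw := hnorm_pos hw
  have pv' := hnorm_pos hv'
  have pw' := hnorm_pos hw'
  have hw : ‖wedge (moebius α β γ v) (moebius α β γ w)‖ = κ * ‖wedge v w‖ := by
    have : wedge (moebius α β γ v) (moebius α β γ w) =
        wedge γ β * wedge γ α * (wedge v w * wedge α β) := by
      rw [← wedge_plucker]; simp only [moebius]; simp only [wedge]; ring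
    rw [this, norm_mul, norm_mul, norm_mul, hκ]; ring
  rw [hw, div_le_iff₀ (by positivity)]
  have hprod : hnorm (moebius α β γ v) * hnorm (moebius α β γ w) ≤
      (L * hnorm v) * (L * hnorm w) := mul_le_mul (hM v) (hM w) pw'.le (by positivity)
  have e : L ^ 2 / κ * (2 * (κ * ‖wedge v w‖) /
      (hnorm (moebius α β γ v) * hnorm (moebius α β γ w))) * (hnorm v * hnorm w) =
      2 * ‖wedge v w‖ * (((L * hnorm v) * (L * hnorm w)) /
        (hnorm (moebius α β γ v) * hnorm (moebius α β γ w))) := by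
    field_simp
  rw [e]
  exact le_mul_of_one_le_right (by positivity) ((one_le_div (by positivity)).2 hprod)

/-- Holomorphic curves that omit three points are uniformly Lipschitz on a smaller disc. -/
lemma exists_lipschitz_of_omits {a b c : Sphere} (hab : a ≠ b) (hac : a ≠ c) (hbc : b ≠ c) :
    ∃ C > 0, ∀ V : ℂ → ℂ × ℂ, DifferentiableOn ℂ V (ball 0 1) →
      (∀ t ∈ ball (0 : ℂ) 1, V t ≠ 0 ∧ toSphere (V t) ∉ ({a, b, c} : Set Sphere)) →
      ∀ s ∈ ball (0 : ℂ) (1 / 2), ∀ t ∈ ball (0 : ℂ) (1 / 2),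
        dist (toSphere (V s)) (toSphere (V t)) ≤ C * dist s t := by
  have key : ∀ {p q : Sphere}, p ≠ q → wedge (rep p) (rep q) ≠ 0 := fun {p q} hpq =>
    wedge_ne_zero (rep_ne_zero p) (rep_ne_zero q) (by simpa using hpq)
  have h1 := key hab
  have h2 := key hac.symm
  have h3 := key hbc.symm
  obtain ⟨K, hK, hM⟩ := exists_dist_le_moebius h1 h2 h3
  obtain ⟨C, hC, hlandau⟩ := exists_landau_bound
  refine ⟨K * (3 * C), by positivity, fun V hV hom s hs t ht => ?_⟩
  have hω : ∀ t ∈ ball (0 : ℂ) 1, ∀ p ∈ ({a, b, c} : Set Sphere), wedge (V t) (rep p) ≠ 0 :=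
    fun t ht p hp => wedge_ne_zero (hom t ht).1 (rep_ne_zero p) fun h => (hom t ht).2 (by
      rw [h, toSphere_rep]; exact hp)
  have hωa := fun t ht => hω t ht a (by simp)
  have hωb := fun t ht => hω t ht b (by simp)
  have hωc := fun t ht => hω t ht c (by simp)
  have hden : ∀ t ∈ ball (0 : ℂ) 1, (moebius (rep a) (rep b) (rep c) (V t)).2 ≠ 0 :=
    fun t ht => mul_ne_zero (hωb t ht) h2
  set f : ℂ → ℂ := fun t => (moebius (rep a) (rep b) (rep c) (V t)).1 /
    (moebius (rep a) (rep b) (rep c) (V t)).2 with hf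
  have hfd : DifferentiableOn ℂ f (ball 0 1) := by
    refine DifferentiableOn.div ?_ ?_ hden <;>
    · simp only [moebius, wedge]
      fun_prop
  have hf01 : ∀ t ∈ ball (0 : ℂ) 1, f t ≠ 0 ∧ f t ≠ 1 := by
    intro t ht
    refine ⟨div_ne_zero (mul_ne_zero (hωa t ht) h3) (hden t ht), fun h => ?_⟩
    have h4 := sub_eq_zero.2 ((div_eq_one_iff_eq (hden t ht)).1 h)
    -- By the Plücker relation, `f t = 1` would force `V t` to represent `c`.
    have h5 := wedge_plucker (rep a) (rep b) (V t) (rep c)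
    simp only [moebius] at h4
    rw [h4] at h5
    exact mul_ne_zero (hωc t ht) h1 h5.symm
  have hsub : ball (0 : ℂ) (1 / 2) ⊆ ball 0 1 := ball_subset_ball (by norm_num)
  have hlip := dist_le_of_deriv_bound isOpen_ball (convex_ball 0 (1 / 2)) (hfd.mono hsub) hC
    (hlandau f hfd hf01) ht hs
  have hts : ∀ t ∈ ball (0 : ℂ) 1,
      toSphere (moebius (rep a) (rep b) (rep c) (V t)) = (f t : Sphere) := fun t ht => by
    rw [toSphere, if_neg (hden t ht)]
  have hne : ∀ t ∈ ball (0 : ℂ) 1, moebius (rep a) (rep b) (rep c) (V t) ≠ 0 := fun t ht h =>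
    hden t ht (by rw [h]; rfl)
  have := hM _ _ (hom s (hsub hs)).1 (hom t (hsub ht)).1 (hne s (hsub hs)) (hne t (hsub ht))
  rw [hts s (hsub hs), hts t (hsub ht)] at this
  calc _ ≤ _ := this
    _ ≤ K * (3 * C * ‖s - t‖) := by gcongr
    _ = _ := by rw [dist_eq_norm]; ring

/-- **Montel's theorem** for the iterates of a rational map: they are normal on every open set on
which they omit three points. -/
theorem subset_fatouSet_of_omits (R : RatFunc ℂ) {U A : Set Sphere} (hU : IsOpen U)
    (hA : 3 ≤ A.encard) (hom : ∀ z ∈ U, ∀ n, 0 < n → (ratMap R)^[n] z ∉ A) : U ⊆ fatouSet R := by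
  intro z₀ hz₀
  obtain ⟨T, hTA, hT⟩ := exists_subset_encard_eq hA
  obtain ⟨a, b, c, hab, hac, hbc, rfl⟩ := encard_eq_three.1 hT
  obtain ⟨C, hC, hlip⟩ := exists_lipschitz_of_omits hab hac hbc
  -- Any second point would do: it serves to parametrize a neighbourhood of `z₀` by a holomorphic
  -- line in `ℂ²`.
  obtain ⟨z₁, hz₁⟩ := exists_dist_eq_two z₀
  have hz01 : z₀ ≠ z₁ := fun h => by rw [h, dist_self] at hz₁; norm_num at hz₁
  have hv0 := rep_ne_zero z₀
  have hv1 := rep_ne_zero z₁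
  have hω : wedge (rep z₀) (rep z₁) ≠ 0 := wedge_ne_zero hv0 hv1 (by simpa using hz01)
  have hline : ∀ t : ℂ, rep z₀ + t • rep z₁ ≠ 0 := fun t h => hω (by
    have : wedge (rep z₀ + t • rep z₁) (rep z₁) = wedge (rep z₀) (rep z₁) := by
      simp [wedge]; ring
    rw [← this, h]; simp [wedge])
  have hcont : Continuous fun t : ℂ => toSphere (rep z₀ + t • rep z₁) :=
    continuousOn_toSphere.comp_continuous (by fun_prop) hline
  obtain ⟨r, hr, hball⟩ := Metric.isOpen_iff.1 (hU.preimage hcont) 0 (by simpa using hz₀)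
  have hrne : (r : ℂ) ≠ 0 := Complex.ofReal_ne_zero.2 hr.ne'
  set χ : ℂ → ℂ × ℂ := fun t => rep z₀ + ((r : ℂ) * t) • rep z₁ with hχ
  have hχU : ∀ t ∈ ball (0 : ℂ) 1, toSphere (χ t) ∈ U := fun t ht => hball (by
    rw [mem_ball_zero_iff] at ht ⊢
    rw [norm_mul, Complex.norm_real, Real.norm_of_nonneg hr.le]
    nlinarith)
  have hχ0 : ∀ t, χ t ≠ 0 := fun t => hline _
  -- The points whose parameter `t` on the curve `χ` has modulus less than `1 / 4`, expressed by
  -- distances so that openness is evident.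
  set W : Set Sphere := {p | dist p z₀ * hnorm (rep z₀) <
    r / 4 * (dist p z₁ * hnorm (rep z₁))} with hW
  have hWo : IsOpen W := isOpen_lt (by fun_prop) (by fun_prop)
  have hp1 := hnorm_pos hv1
  have hp0 := hnorm_pos hv0
  have hzW : z₀ ∈ W := by
    simp only [hW, mem_ofPred_eq, dist_self, zero_mul]
    have := dist_pos.2 hz01
    positivity
  have hparam : ∀ p ∈ W, ∃ t ∈ closedBall (0 : ℂ) (1 / 4), toSphere (χ t) = p := by
    intro p hp
    have hpr := rep_ne_zero p
    have hpp := hnorm_pos hpr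
    simp only [hW, mem_ofPred_eq, dist_eq_wedge_rep] at hp
    have hlt : ‖wedge (rep p) (rep z₀)‖ < r / 4 * ‖wedge (rep p) (rep z₁)‖ := by
      have e0 : 2 * ‖wedge (rep p) (rep z₀)‖ / (hnorm (rep p) * hnorm (rep z₀)) * hnorm (rep z₀) =
        ‖wedge (rep p) (rep z₀)‖ * (2 / hnorm (rep p)) := by field_simp
      have e1 : r / 4 * (2 * ‖wedge (rep p) (rep z₁)‖ / (hnorm (rep p) * hnorm (rep z₁)) *
        hnorm (rep z₁)) = r / 4 * ‖wedge (rep p) (rep z₁)‖ * (2 / hnorm (rep p)) := by field_simp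
      rw [e0, e1] at hp
      exact lt_of_mul_lt_mul_right hp (by positivity)
    have hne : wedge (rep p) (rep z₁) ≠ 0 := fun h => by
      rw [h, norm_zero, mul_zero] at hlt
      exact absurd hlt (not_lt.2 (norm_nonneg _))
    have hpos := norm_pos_iff.2 hne
    refine ⟨-(wedge (rep p) (rep z₀) / wedge (rep p) (rep z₁)) / r, ?_, ?_⟩
    · rw [mem_closedBall_zero_iff, norm_div, norm_neg, norm_div, Complex.norm_real,
        Real.norm_of_nonneg hr.le, div_div, div_le_iff₀ (by positivity)]
      linarith
    · rw [← toSphere_rep p, toSphere_eq_iff (hχ0 _) (by simpa using hpr)]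
      simp only [hχ, mul_div_cancel₀ _ hrne, toSphere_rep]
      have : ∀ s : ℂ, wedge (rep z₀ + s • rep z₁) (rep p) =
          -wedge (rep p) (rep z₀) - s * wedge (rep p) (rep z₁) := fun s => by
        simp [wedge]; ring
      rw [this]
      field_simp
      ring
  refine ⟨W, hWo, hzW, UniformlyNormalOn.isNormalFamilyOn fun f hf => ?_⟩
  choose N hN0 hN using hf
  obtain ⟨φ, hφ, G, hG⟩ := exists_subseq_of_lipschitz
    (q := fun k t => toSphere ((homLift R)^[N k] (χ t))) (C := C) (ρ := 1 / 4) (by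
      intro k s hs t ht
      have hsub : closedBall (0 : ℂ) (1 / 4) ⊆ ball 0 (1 / 2) :=
        closedBall_subset_ball (by norm_num)
      refine hlip (fun t => (homLift R)^[N k] (χ t)) ?_ ?_ s (hsub hs) t (hsub ht)
      · have h1 : Differentiable ℂ χ := by simp only [hχ]; fun_prop
        exact (((differentiable_homLift R).iterate (N k)).comp h1).differentiableOn
      · intro t ht
        refine ⟨homLift_iterate_ne_zero R _ (hχ0 t), fun h => ?_⟩
        rw [toSphere_homLift_iterate R _ (hχ0 t)] at h
        exact hom _ (hχU t ht) (N k) (hN0 k) (hTA h))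
  choose! τ hτ hχτ using hparam
  refine ⟨φ, hφ, fun p => G (τ p), fun ε hε => ?_⟩
  obtain ⟨M, hM⟩ := hG ε hε
  refine ⟨M, fun n hn p hp => ?_⟩
  have := hM n hn (τ p) (hτ p hp)
  rwa [toSphere_homLift_iterate R _ (hχ0 _), hχτ p hp, ← hN] at this

/-! ### Complete invariance of the Fatou and Julia sets. -/

lemma mem_fatouSet_iff {R : RatFunc ℂ} {z : Sphere} :
    z ∈ fatouSet R ↔ ∃ K ∈ 𝓝 z, UniformlyNormalOn (iterates R) K := by
  constructor
  · rintro ⟨U, hU, hzU, hN⟩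
    obtain ⟨K, hK, hzK, hKU⟩ := exists_compact_subset hU hzU
    exact ⟨K, mem_interior_iff_mem_nhds.1 hzK, hN.uniformlyNormalOn hK hKU⟩
  · rintro ⟨K, hK, hN⟩
    exact ⟨interior K, isOpen_interior, mem_interior_iff_mem_nhds.2 hK,
      (hN.mono interior_subset).isNormalFamilyOn⟩

lemma isOpen_fatouSet (R : RatFunc ℂ) : IsOpen (fatouSet R) := by
  rw [isOpen_iff_forall_mem_open]
  rintro z ⟨U, hU, hzU, hN⟩
  exact ⟨U, fun w hw => ⟨U, hU, hw, hN⟩, hU, hzU⟩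

lemma mem_fatouSet_of_ratMap_mem {R : RatFunc ℂ} (hR : 1 ≤ ratDegree R) {z : Sphere}
    (hz : ratMap R z ∈ fatouSet R) : z ∈ fatouSet R := by
  obtain ⟨K, hK, hN⟩ := mem_fatouSet_iff.1 hz
  refine mem_fatouSet_iff.2
    ⟨ratMap R ⁻¹' K, (continuous_ratMap hR).continuousAt.preimage_mem_nhds hK, fun f hf => ?_⟩
  choose n hn0 hn using hf
  -- One factor of `R` is to be split off, but the identity is not in the family; exponent `1` is
  -- treated apart.
  by_cases hfreq : ∃ᶠ k in atTop, n k = 1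
  · obtain ⟨φ, hφ, h⟩ := extraction_of_frequently_atTop hfreq
    refine ⟨φ, hφ, ratMap R, fun ε hε => ⟨0, fun k _ w _ => ?_⟩⟩
    rw [hn, h, Function.iterate_one, dist_self]
    exact hε
  · obtain ⟨M, hM⟩ := eventually_atTop.1 (not_frequently.1 hfreq)
    have hlt : ∀ k, 1 < n (k + M) := fun k => by
      have := hM (k + M) (by omega)
      have := hn0 (k + M)
      omega
    obtain ⟨φ, hφ, g, hg⟩ := hN (fun k => (ratMap R)^[n (k + M) - 1])
      fun k => ⟨_, Nat.sub_pos_of_lt (hlt k), rfl⟩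
    refine ⟨fun k => φ k + M, fun i j hij => Nat.add_lt_add_right (hφ hij) M, g ∘ ratMap R,
      fun ε hε => ?_⟩
    obtain ⟨N, hN⟩ := hg ε hε
    refine ⟨N, fun k hk w hw => ?_⟩
    have := hN k hk (ratMap R w) hw
    rwa [← Function.iterate_succ_apply, Nat.succ_eq_add_one,
      Nat.sub_add_cancel (hlt (φ k)).le, ← hn] at this

/-- Openness makes the image of a neighbourhood a neighbourhood, and `R^(n+1)` on `K` descends to
`R^n` on the image through any set-theoretic section. -/
lemma ratMap_mem_fatouSet {R : RatFunc ℂ} (hR : 1 ≤ ratDegree R) {z : Sphere}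
    (hz : z ∈ fatouSet R) : ratMap R z ∈ fatouSet R := by
  obtain ⟨K, hK, hN⟩ := mem_fatouSet_iff.1 hz
  refine mem_fatouSet_iff.2
    ⟨ratMap R '' K, (isOpenMap_ratMap hR).image_mem_nhds hK, fun f hf => ?_⟩
  choose n hn0 hn using hf
  obtain ⟨φ, hφ, g, hg⟩ := hN (fun k => (ratMap R)^[n k + 1])
    fun k => ⟨n k + 1, Nat.succ_pos _, rfl⟩
  have hsec : ∀ w ∈ ratMap R '' K, ∃ a ∈ K, ratMap R a = w := fun w hw => hw
  choose! σ hσ hRσ using hsec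
  refine ⟨φ, hφ, g ∘ σ, fun ε hε => ?_⟩
  obtain ⟨N, hN⟩ := hg ε hε
  refine ⟨N, fun k hk w hw => ?_⟩
  have := hN k hk (σ w) (hσ w hw)
  rwa [Function.iterate_succ_apply, hRσ w hw, ← hn] at this

lemma completelyInvariant_of_preimage_eq {R : RatFunc ℂ} (hR : 1 ≤ ratDegree R) {E : Set Sphere}
    (h : ratMap R ⁻¹' E = E) : CompletelyInvariant (ratMap R) E :=
  ⟨by conv_lhs => rw [← h]
      exact image_preimage_eq E (surjective_ratMap hR), h⟩

lemma preimage_juliaSet {R : RatFunc ℂ} (hR : 1 ≤ ratDegree R) :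
    ratMap R ⁻¹' juliaSet R = juliaSet R := by
  rw [juliaSet, preimage_compl]
  congr 1
  ext z
  exact ⟨mem_fatouSet_of_ratMap_mem hR, ratMap_mem_fatouSet hR⟩

/-! ### Finite completely invariant sets. -/

/-- The points of a finite completely invariant set are superattracting periodic points, hence
they lie in the Fatou set. -/
theorem subset_fatouSet_of_finite {R : RatFunc ℂ} (hR : 2 ≤ ratDegree R) {E : Set Sphere}
    (hfin : E.Finite) (hE : CompletelyInvariant (ratMap R) E) : E ⊆ fatouSet R := by
  have hinj : InjOn (ratMap R) E :=
    hfin.injOn_of_encard_image_eq (by rw [hE.1])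
  have hmaps : ∀ a ∈ E, ratMap R a ∈ E := fun a ha => by
    rw [← hE.2] at ha; exact ha
  have hit : ∀ n, ∀ a ∈ E, (ratMap R)^[n] a ∈ E := fun n a ha =>
    MapsTo.iterate (fun a ha => hmaps a ha) n ha
  -- The fibre of `R a` lies in `E`, where `R` is injective, so it is `{a}`.
  have hloc : ∀ a ∈ E, ∃ C > 0, ∀ z, dist (ratMap R z) (ratMap R a) ≤ C * dist z a ^ 2 :=
    fun a ha => exists_dist_le_sq hR fun b hb => hinj (by
      rw [← hE.2, mem_preimage, hb]; exact hmaps a ha) ha hb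
  choose! c hc0 hc using hloc
  obtain ⟨B, hB⟩ := (hfin.image c).bddAbove
  set C := max B 1 with hC
  have hC0 : 0 < C := lt_max_of_lt_right one_pos
  have hsq : ∀ a ∈ E, ∀ z, dist (ratMap R z) (ratMap R a) ≤ C * dist z a ^ 2 := fun a ha z => by
    refine (hc a ha z).trans ?_
    gcongr
    exact (hB (mem_image_of_mem c ha)).trans (le_max_left _ _)
  set ε := 1 / (2 * C) with hε
  have hε0 : 0 < ε := by positivity
  have hcontr : ∀ a ∈ E, ∀ z, dist z a ≤ ε → ∀ n,
      dist ((ratMap R)^[n] z) ((ratMap R)^[n] a) ≤ ε * (1 / 2) ^ n := by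
    intro a ha z hz n
    induction n with
    | zero => simpa using hz
    | succ n ih =>
      rw [Function.iterate_succ_apply', Function.iterate_succ_apply']
      have h1 := hsq _ (hit n a ha) ((ratMap R)^[n] z)
      set δ := dist ((ratMap R)^[n] z) ((ratMap R)^[n] a)
      have hδ : 0 ≤ δ := dist_nonneg
      have h2 : δ ≤ ε := ih.trans (mul_le_of_le_one_right hε0.le
        (pow_le_one₀ (by norm_num) (by norm_num)))
      calc _ ≤ C * δ ^ 2 := h1
        _ = C * δ * δ := by ring
        _ ≤ C * ε * (ε * (1 / 2) ^ n) := by gcongr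
        _ = _ := by rw [hε]; field_simp; ring
  intro a ha
  refine mem_fatouSet_iff.2 ⟨closedBall a ε, closedBall_mem_nhds a hε0, fun f hf => ?_⟩
  choose n hn0 hn using hf
  -- Either some exponent recurs, giving a constant subsequence, or the exponents tend to infinity
  -- and the orbit of `a` in the finite set `E` hits some `b` infinitely often, giving the constant
  -- limit `b`.
  by_cases hfreq : ∃ m, ∃ᶠ k in atTop, n k = m
  · obtain ⟨m, hm⟩ := hfreq
    obtain ⟨φ, hφ, h⟩ := extraction_of_frequently_atTop hm
    refine ⟨φ, hφ, (ratMap R)^[m], fun ε hε => ⟨0, fun k _ w _ => ?_⟩⟩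
    rw [hn, h, dist_self]
    exact hε
  · simp only [not_exists, not_frequently] at hfreq
    have htend : Tendsto n atTop atTop := tendsto_atTop.2 fun b => by
      have := (eventually_all_finite (finite_Iio b)).2 fun m _ => hfreq m
      filter_upwards [this] with k hk
      exact not_lt.1 fun hlt => hk (n k) hlt rfl
    obtain ⟨b, hb⟩ : ∃ b, ∃ᶠ k in atTop, (ratMap R)^[n k] a = b := by
      by_contra hcon
      simp only [not_exists, not_frequently] at hcon
      obtain ⟨k, hk⟩ := ((eventually_all_finite hfin).2 fun b _ => hcon b).exists
      exact hk _ (hit (n k) a ha) rfl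
    obtain ⟨φ, hφ, h⟩ := extraction_of_frequently_atTop hb
    refine ⟨φ, hφ, fun _ => b, fun η hη => ?_⟩
    have hlim : Tendsto (fun k => ε * (1 / 2 : ℝ) ^ n (φ k)) atTop (𝓝 0) := by
      have := (tendsto_pow_atTop_nhds_zero_of_lt_one (by norm_num : (0 : ℝ) ≤ 1 / 2)
        (by norm_num)).comp (htend.comp hφ.tendsto_atTop)
      simpa using this.const_mul ε
    obtain ⟨N, hN⟩ := eventually_atTop.1 (hlim.eventually_lt_const hη)
    refine ⟨N, fun k hk z hz => ?_⟩
    rw [hn, ← h k]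
    exact (hcontr a ha z hz _).trans_lt (hN k hk)

/-! ### Minimality of the Julia set and the exceptional points. -/

lemma juliaSet_infinite {R : RatFunc ℂ} (hR : 2 ≤ ratDegree R) : (juliaSet R).Infinite := by
  intro hfin
  obtain ⟨z, hz⟩ := juliaSet_nonempty hR
  have hR1 : 1 ≤ ratDegree R := one_le_two.trans hR
  exact hz (subset_fatouSet_of_finite hR hfin
    (completelyInvariant_of_preimage_eq hR1 (preimage_juliaSet hR1)) hz)

lemma iterate_mem_iff_of_preimage_eq {R : RatFunc ℂ} {E : Set Sphere}
    (h : ratMap R ⁻¹' E = E) (n : ℕ) (z : Sphere) : (ratMap R)^[n] z ∈ E ↔ z ∈ E := by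
  induction n generalizing z with
  | zero => rfl
  | succ n ih =>
    rw [Function.iterate_succ_apply, ih]
    exact Set.ext_iff.1 h z

lemma juliaSet_subset {R : RatFunc ℂ} {E : Set Sphere}
    (hcl : IsClosed E) (hE : CompletelyInvariant (ratMap R) E) (h3 : 3 ≤ E.encard) :
    juliaSet R ⊆ E := by
  have := subset_fatouSet_of_omits R hcl.isOpen_compl h3 fun z hz n _ h =>
    hz ((iterate_mem_iff_of_preimage_eq hE.2 n z).1 h)
  exact compl_subset_comm.1 this

lemma three_le_encard_of_infinite {E : Set Sphere} (h : E.Infinite) : 3 ≤ E.encard := by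
  rw [h.encard_eq]; exact le_top

lemma encard_le_two_of_not {E : Set Sphere} (h : ¬ 3 ≤ E.encard) : E.encard ≤ 2 := by
  rw [not_le] at h
  exact Order.le_of_lt_add_one (by simpa [two_add_one_eq_three] using h)

lemma exceptionalSet_subset_fatouSet {R : RatFunc ℂ} (hR : 2 ≤ ratDegree R) :
    exceptionalSet R ⊆ fatouSet R := by
  rintro w ⟨z₀, hz₀, U, hU, hw⟩
  have hR1 : 1 ≤ ratDegree R := one_le_two.trans hR
  set A := omittedSet R (interior U) with hA
  have hmemA : ∀ p, p ∈ A ↔ ∀ n, 0 < n → ∀ z ∈ interior U, (ratMap R)^[n] z ≠ p := by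
    intro p
    simp only [hA, omittedSet, mem_compl_iff, mem_iUnion, mem_image, not_exists, not_and]
  have hwA : w ∈ A := by
    rw [hmemA]
    intro n hn z hz h
    exact hw (mem_iUnion.2 ⟨n, mem_iUnion.2 ⟨hn, z, interior_subset hz, h⟩⟩)
  have hcard : A.encard ≤ 2 := encard_le_two_of_not fun h3 =>
    hz₀ (subset_fatouSet_of_omits R isOpen_interior h3
      (fun z hz n hn h => (hmemA _).1 h n hn z hz rfl) (mem_interior_iff_mem_nhds.2 hU))
  have hfin : A.Finite := finite_of_encard_le_coe (k := 2) hcard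
  have hsub : ratMap R ⁻¹' A ⊆ A := by
    intro p hp
    rw [hmemA]
    intro n hn z hz h
    refine (hmemA _).1 hp (n + 1) n.succ_pos z hz ?_
    rw [Function.iterate_succ_apply', h]
  -- By surjectivity `A` is the image of its preimage, so the preimage is a subset of `A` with no
  -- fewer points; finiteness gives equality.
  have hpre : ratMap R ⁻¹' A = A := by
    refine (hfin.subset hsub).eq_of_subset_of_encard_le hsub ?_
    conv_lhs => rw [← image_preimage_eq A (surjective_ratMap hR1)]
    exact encard_image_le _ _
  exact subset_fatouSet_of_finite hR hfin (completelyInvariant_of_preimage_eq hR1 hpre) hwA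

/-- The complement of `E` is a neighbourhood of any Julia point, and no orbit starting there enters
`E`. -/
lemma subset_exceptionalSet_of_finite {R : RatFunc ℂ} (hR : 2 ≤ ratDegree R) {E : Set Sphere}
    (hfin : E.Finite) (hE : CompletelyInvariant (ratMap R) E) : E ⊆ exceptionalSet R := by
  intro w hw
  obtain ⟨z₀, hz₀⟩ := juliaSet_nonempty hR
  have hzE : z₀ ∉ E := fun h => hz₀ (subset_fatouSet_of_finite hR hfin hE h)
  refine ⟨z₀, hz₀, Eᶜ, hfin.isClosed.isOpen_compl.mem_nhds hzE, ?_⟩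
  simp only [omittedSet, mem_compl_iff, mem_iUnion, mem_image, not_exists, not_and]
  rintro n - z hz rfl
  exact hz ((iterate_mem_iff_of_preimage_eq hE.2 n z).1 hw)

end

end RationalDynamics

theorem theorem1p5p13 (R : RatFunc ℂ) (hR : 2 ≤ RationalDynamics.ratDegree R) :
    (∀ E : Set RationalDynamics.Sphere, IsClosed E →
      RationalDynamics.CompletelyInvariant (RationalDynamics.ratMap R) E →
        (E.encard ≤ 2 ∧ E ⊆ RationalDynamics.exceptionalSet R ∧
          RationalDynamics.exceptionalSet R ⊆ RationalDynamics.fatouSet R) ∨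
        (E.Infinite ∧ RationalDynamics.juliaSet R ⊆ E)) ∧
    IsLeast
      {E : Set RationalDynamics.Sphere | IsClosed E ∧
        RationalDynamics.CompletelyInvariant (RationalDynamics.ratMap R) E ∧ 3 ≤ E.encard}
      (RationalDynamics.juliaSet R) := by
  open RationalDynamics in
  have hR1 : 1 ≤ ratDegree R := one_le_two.trans hR
  refine ⟨fun E hcl hE => ?_, ⟨(isOpen_fatouSet R).isClosed_compl,
    completelyInvariant_of_preimage_eq hR1 (preimage_juliaSet hR1),
    three_le_encard_of_infinite (juliaSet_infinite hR)⟩, fun E ⟨hcl, hE, h3⟩ =>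
    juliaSet_subset hcl hE h3⟩
  rcases E.finite_or_infinite with hfin | hinf
  · refine Or.inl ⟨encard_le_two_of_not fun h3 => ?_, subset_exceptionalSet_of_finite hR hfin hE,
      exceptionalSet_subset_fatouSet hR⟩
    exact juliaSet_infinite hR (hfin.subset (juliaSet_subset hcl hE h3))
  · exact Or.inr ⟨hinf, juliaSet_subset hcl hE (three_le_encard_of_infinite hinf)⟩
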